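/- Let $\Bbbk$ be a field of characteristic zero (e.g. $\mathbb R$ or $\mathbb C$) and let $d\ge 0$ be the dimension of spacetime (for instance $d=4$). Consider finitely many fields $\varphi_i$ of Grassmann parity $\epsilon_i$, and finitely many pairs of fields $(z_k,w_k)$, where $w_k$ has the opposite parity to $z_k$. Let $\mathcal L$ be the space of local formal power series with constant coefficients in all these graded-commuting fields and their derivatives of all orders: arbitrary, possibly infinite, linear combinations of monomials in the variables $\partial_I\varphi_i,\partial_I z_k,\partial_I w_k$. Let $\Sigma=\mathcal L/\sum_\mu\partial_\mu\mathcal L$ be the space of integrated local formal power series, where $\partial_\mu$ are the total derivatives and the class of $X$ is written $\int X$. Both spaces are graded by the number of factors $\partial_Iz_k,\partial_Iw_k$ (the eigenvalue of the counting operator $\mathcal N$ of the doublets); a superscript $(j)$ denotes the component of degree $j$. Let $\Sigma^{(0)}\subseteq\Sigma$ be the subspace of the functionals $\int X$ with $X$ depending only on the $\varphi_i$ and their derivatives. Let $g_i\in\mathcal L$ have parity $\epsilon_i+1$, and let $$s=\int d^dx\,\Big(\sum_i g_i\frac{\delta}{\delta\varphi_i}+\sum_k w_k\frac{\delta}{\delta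 z_k}\Big):\Sigma\to\Sigma$$ (left functional derivatives), so that $s\varphi_i=g_i$, $sz_k=w_k$, $sw_k=0$. Assume $s^2=0$ on $\Sigma$. It is not assumed that $s$ commutes with $\mathcal N$: the $g_i$ may depend on the doublets. Let $$\bar s^{(0)}=\int d^dx\,\sum_i g_i^{(0)}\frac{\delta}{\delta\varphi_i}:\Sigma^{(0)}\to\Sigma^{(0)} .$$ Then $(\bar s^{(0)})^2=0$ on $\Sigma^{(0)}$; if $\mathcal I\in\Sigma$ satisfies $s\mathcal I=0$, then $\bar s^{(0)}\mathcal I^{(0)}=0$; and $[\mathcal I]\mapsto[\mathcal I^{(0)}]$ is a well-defined linear isomorphism $$H(s,\Sigma)=\frac{\ker s}{\operatorname{im}s}\;\xrightarrow{\ \cong\ }\;H(\bar s^{(0)},\Sigma^{(0)})=\frac{\ker\bar s^{(0)}}{\operatorname{im}\bar s^{(0)}} .$$ -/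

import Mathlib

/-! Local formal power series in graded commuting fields and their derivatives, integrated local
functionals, and the differential of a theory with coupled doublets. -/

namespace Doublets

noncomputable section

/-! ### Formal power series in graded commuting variables -/

section Series

variable {𝕜 : Type*} [Field 𝕜] {V : Type*}

/-- The Koszul sign `(-1) ^ (a b)` of two Grassmann parities. -/
def koszul (𝕜 : Type*) [Field 𝕜] (a b : ZMod 2) : 𝕜 := if a = 1 ∧ b = 1 then -1 else 1

/-- The Grassmann parity of the word `v₁ v₂ ⋯ vₙ`. -/
def wordParity (p : V → ZMod 2) (l : List V) : ZMod 2 := (l.map p).sum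

/-- The space of formal power series, with coefficients in the field `𝕜` of characteristic zero,
in the variables `V`, where `v` has Grassmann parity `p v` and
`u v = (-1) ^ (p u p v) v u`. A series `X` is recorded by its Taylor coefficients:
`X [v₁, …, vₙ]` is the value at zero of `∂/∂vₙ ⋯ ∂/∂v₁ X` (left derivatives). For a word
`v₁, …, vₙ` this is the coefficient of the monomial `v₁ ⋯ vₙ` in `X` times the product of the
factorials of the exponents of the monomial. The only constraint is that
the coefficients are graded symmetric, so a series is an arbitrary family of coefficients indexed
by the monomials in which odd variables occur at most once. -/
def Series (𝕜 : Type*) [Field 𝕜] (p : V → ZMod 2) : Submodule 𝕜 (List V → 𝕜) where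
  carrier := {X | ∀ l u v l', X (l ++ u :: v :: l') = koszul 𝕜 (p u) (p v) * X (l ++ v :: u :: l')}
  zero_mem' := by intro l u v l'; simp
  add_mem' := by
    intro X Y hX hY l u v l'
    simp only [Pi.add_apply]
    rw [hX, hY]; ring
  smul_mem' := by
    intro c X hX l u v l'
    simp only [Pi.smul_apply, smul_eq_mul]
    rw [hX]; ring

/-- The series `X` has only monomials of Grassmann parity `e`. -/
def HasParity {p : V → ZMod 2} (X : Series 𝕜 p) (e : ZMod 2) : Prop :=
  ∀ l, wordParity p l ≠ e → X.1 l = 0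

open Classical in
/-- The variable `v` as a power series. -/
def var (𝕜 : Type*) [Field 𝕜] (p : V → ZMod 2) (v : V) : Series 𝕜 p :=
  ⟨fun l => if l = [v] then 1 else 0, by
    intro l a b l'
    have h : ∀ a b : V, l ++ a :: b :: l' ≠ [v] := by
      intro a b h
      have := congrArg List.length h
      simp at this
      omega
    simp [h]⟩

/-- The left partial derivative `∂/∂v`. -/
def pderiv {p : V → ZMod 2} (v : V) : Series 𝕜 p →ₗ[𝕜] Series 𝕜 p where
  toFun X := ⟨fun l => X.1 (v :: l), fun l a b l' => X.2 (v :: l) a b l'⟩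
  map_add' _ _ := rfl
  map_smul' _ _ := rfl

/-- The Taylor coefficients of the product of two series. They are determined by the product of
the constant terms and by the graded Leibniz rule for left derivatives,
`∂/∂v (X Y) = (∂X/∂v) Y + (-1) ^ (p v p X) X (∂Y/∂v)`. -/
def rawMul (p : V → ZMod 2) : (List V → 𝕜) → (List V → 𝕜) → List V → 𝕜
  | X, Y, [] => X [] * Y []
  | X, Y, v :: l =>
      rawMul p (fun m => X (v :: m)) Y l
        + rawMul p (fun m => koszul 𝕜 (p v) (wordParity p m) * X m) (fun m => Y (v :: m)) l

theorem koszul_mul_self (a b : ZMod 2) : koszul 𝕜 a b * koszul 𝕜 a b = 1 := by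
  unfold koszul; split_ifs <;> simp

theorem koszul_comm (a b : ZMod 2) : koszul 𝕜 a b = koszul 𝕜 b a := by
  unfold koszul; simp [and_comm]

theorem koszul_add (a b c : ZMod 2) : koszul 𝕜 a (b + c) = koszul 𝕜 a b * koszul 𝕜 a c := by
  have h : ∀ a b c : ZMod 2, (a = 1 ∧ b + c = 1 ↔ ¬ (a = 1 ∧ b = 1 ↔ a = 1 ∧ c = 1)) := by decide
  unfold koszul
  have := h a b c
  split_ifs <;> simp_all

theorem koszul_zero (a : ZMod 2) : koszul 𝕜 a 0 = 1 := by
  unfold koszul; simp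

theorem rawMul_add_left (p : V → ZMod 2) (l : List V) (X X' Y : List V → 𝕜) :
    rawMul p (fun m => X m + X' m) Y l = rawMul p X Y l + rawMul p X' Y l := by
  induction l generalizing X X' Y with
  | nil => simp [rawMul]; ring
  | cons v l ih =>
    simp only [rawMul, mul_add, ih]; ring

theorem rawMul_add_right (p : V → ZMod 2) (l : List V) (X Y Y' : List V → 𝕜) :
    rawMul p X (fun m => Y m + Y' m) l = rawMul p X Y l + rawMul p X Y' l := by
  induction l generalizing X Y Y' with
  | nil => simp [rawMul]; ring
  | cons v l ih =>
    simp only [rawMul, ih]; ring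

theorem rawMul_smul_left (p : V → ZMod 2) (l : List V) (c : 𝕜) (X Y : List V → 𝕜) :
    rawMul p (fun m => c * X m) Y l = c * rawMul p X Y l := by
  induction l generalizing X Y with
  | nil => simp [rawMul]; ring
  | cons v l ih =>
    simp only [rawMul, mul_left_comm _ c, ih]; ring

theorem rawMul_smul_right (p : V → ZMod 2) (l : List V) (c : 𝕜) (X Y : List V → 𝕜) :
    rawMul p X (fun m => c * Y m) l = c * rawMul p X Y l := by
  induction l generalizing X Y with
  | nil => simp [rawMul]; ring
  | cons v l ih =>
    simp only [rawMul, ih]; ring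

/-- A coefficient of a product comes from splittings of the word. -/
theorem rawMul_support (p : V → ZMod 2) (l : List V) (X Y : List V → 𝕜)
    (h : rawMul p X Y l ≠ 0) : ∃ l₁ l₂, (l₁ ++ l₂).Perm l ∧ X l₁ ≠ 0 ∧ Y l₂ ≠ 0 := by
  induction l generalizing X Y with
  | nil =>
    simp only [rawMul] at h
    exact ⟨[], [], List.Perm.refl _, left_ne_zero_of_mul h, right_ne_zero_of_mul h⟩
  | cons v l ih =>
    simp only [rawMul] at h
    by_cases h1 : rawMul p (fun m => X (v :: m)) Y l = 0
    · rw [h1, zero_add] at h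
      obtain ⟨l₁, l₂, hp, hx, hy⟩ := ih _ _ h
      exact ⟨l₁, v :: l₂, List.perm_middle.trans (hp.cons v), right_ne_zero_of_mul hx, hy⟩
    · obtain ⟨l₁, l₂, hp, hx, hy⟩ := ih _ _ h1
      exact ⟨v :: l₁, l₂, hp.cons v, hx, hy⟩

theorem wordParity_cons (p : V → ZMod 2) (v : V) (l : List V) :
    wordParity p (v :: l) = p v + wordParity p l := by simp [wordParity]

theorem twist_mem {p : V → ZMod 2} (e : ZMod 2) {X : List V → 𝕜} (hX : X ∈ Series 𝕜 p) :
    (fun m => koszul 𝕜 e (wordParity p m) * X m) ∈ Series 𝕜 p := by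
  intro l u v l'
  have : wordParity p (l ++ u :: v :: l') = wordParity p (l ++ v :: u :: l') := by
    simp [wordParity]; ring
  simp only [this, hX l u v l']; ring

theorem rawMul_mem {p : V → ZMod 2} {X Y : List V → 𝕜} (hX : X ∈ Series 𝕜 p)
    (hY : Y ∈ Series 𝕜 p) : rawMul p X Y ∈ Series 𝕜 p := by
  intro l
  induction l generalizing X Y with
  | nil =>
    intro u v l'
    have hX' : ∀ a b m, X (a :: b :: m) = koszul 𝕜 (p a) (p b) * X (b :: a :: m) :=
      fun a b m => hX [] a b m
    have hY' : ∀ a b m, Y (a :: b :: m) = koszul 𝕜 (p a) (p b) * Y (b :: a :: m) :=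
      fun a b m => hY [] a b m
    simp only [List.nil_append, rawMul, wordParity_cons, koszul_add, mul_assoc,
      rawMul_smul_left]
    simp only [hX' u v, hY' u v, rawMul_smul_left, rawMul_smul_right,
      mul_left_comm (koszul 𝕜 (p u) (wordParity p _))]
    rw [koszul_comm (p v) (p u)]
    linear_combination (- rawMul p (fun m => koszul 𝕜 (p v) (wordParity p m) * X (u :: m))
      (fun m => Y (v :: m)) l') * koszul_mul_self (𝕜 := 𝕜) (p u) (p v)
  | cons a l ih =>
    intro u v l'
    have h1 := ih (X := fun m => X (a :: m)) (Y := Y) (fun l => hX (a :: l)) hY u v l'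
    have h2 := ih (twist_mem (p a) hX) (Y := fun m => Y (a :: m)) (fun l => hY (a :: l)) u v l'
    simp only [List.cons_append, rawMul, h1, h2]; ring

/-- The product of two series. -/
def mul {p : V → ZMod 2} (X Y : Series 𝕜 p) : Series 𝕜 p :=
  ⟨rawMul p X.1 Y.1, rawMul_mem X.2 Y.2⟩

/-- Each coefficient of `∑ v, Q v * ∂X/∂v` is a finite sum. -/
def LocallyFinite {p : V → ZMod 2} (Q : V → Series 𝕜 p) : Prop :=
  ∀ l : List V, {v | ∃ l₁ l₂, (l₁ ++ l₂).Perm l ∧ (Q v).1 l₁ ≠ 0}.Finite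

theorem exists_of_finsum_ne_zero {ι : Type*} {f : ι → 𝕜} (h : ∑ᶠ i, f i ≠ 0) : ∃ i, f i ≠ 0 := by
  by_contra hne
  push Not at hne
  exact h (finsum_eq_zero_of_forall_eq_zero hne)

theorem LocallyFinite.finite_support {p : V → ZMod 2} {Q : V → Series 𝕜 p}
    (hQ : LocallyFinite Q) (Y : V → List V → 𝕜) (l : List V) :
    (Function.support fun v => rawMul p (Q v).1 (Y v) l).Finite := by
  refine (hQ l).subset fun v hv => ?_
  obtain ⟨l₁, l₂, h, h1, -⟩ := rawMul_support p l _ _ hv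
  exact ⟨l₁, l₂, h, h1⟩

/-- The operator `X ↦ ∑ v, Q v * ∂X/∂v` on power series. -/
def vectorField {p : V → ZMod 2} (Q : V → Series 𝕜 p) (hQ : LocallyFinite Q) :
    Series 𝕜 p →ₗ[𝕜] Series 𝕜 p where
  toFun X := ⟨fun l => ∑ᶠ v, (mul (Q v) (pderiv v X)).1 l, by
    intro l a b l'
    simp only [(mul _ _).2 l a b l', ← smul_eq_mul]
    rw [smul_finsum]⟩
  map_add' X Y := by
    ext l
    simp only [map_add]
    show ∑ᶠ v, rawMul p (Q v).1 (fun m => (pderiv v X).1 m + (pderiv v Y).1 m) l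
      = ∑ᶠ v, rawMul p (Q v).1 (pderiv v X).1 l + ∑ᶠ v, rawMul p (Q v).1 (pderiv v Y).1 l
    simp only [rawMul_add_right]
    exact finsum_add_distrib (hQ.finite_support _ l) (hQ.finite_support _ l)
  map_smul' c X := by
    ext l
    show ∑ᶠ v, rawMul p (Q v).1 (fun m => c * (pderiv v X).1 m) l
      = c • ∑ᶠ v, rawMul p (Q v).1 (pderiv v X).1 l
    simp only [rawMul_smul_right]
    simp only [← smul_eq_mul]
    rw [smul_finsum]

end Series

/-! ### Jet variables, total derivatives, integrated functionals -/

section Jets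

variable {𝕜 : Type*} [Field 𝕜] {F : Type*} {d : ℕ}

/-- The jet variables: `(a, I)` is the derivative `∂_I` of the field `a` on a spacetime of
dimension `d`, where `I` is a multi-index. -/
abbrev Jet (F : Type*) (d : ℕ) : Type _ := F × (Fin d → ℕ)

/-- A derivative of a field has the parity of the field. -/
def jetParity (p : F → ZMod 2) (d : ℕ) (v : Jet F d) : ZMod 2 := p v.1

/-- Local formal power series: formal power series with constant coefficients in the fields and
all their derivatives. -/
abbrev LocalSeries (𝕜 : Type*) [Field 𝕜] (p : F → ZMod 2) (d : ℕ) : Type _ :=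
  ↥(Series 𝕜 (jetParity p d))

/-- `∂_μ` of a jet variable. -/
def raise (μ : Fin d) (v : Jet F d) : Jet F d := (v.1, v.2 + Pi.single μ 1)

theorem raise_injective (μ : Fin d) : Function.Injective (raise (F := F) μ) := by
  rintro ⟨a, I⟩ ⟨b, J⟩ h
  simp only [raise, Prod.mk.injEq, add_left_inj] at h
  exact Prod.ext h.1 h.2

theorem var_raise_locallyFinite (p : F → ZMod 2) (μ : Fin d) :
    LocallyFinite fun v => var 𝕜 (jetParity p d) (raise μ v) := by
  intro l
  refine ((List.finite_toSet l).preimage (raise_injective μ).injOn).subset ?_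
  rintro v ⟨l₁, l₂, h, h1⟩
  have : l₁ = [raise μ v] := by
    by_contra hne
    exact h1 (if_neg hne)
  subst this
  exact h.subset (by simp)

/-- The total derivative `∂_μ = ∑_{a, I} (∂_μ ∂_I a) ∂/∂(∂_I a)`. -/
def totalDeriv (p : F → ZMod 2) (μ : Fin d) : LocalSeries 𝕜 p d →ₗ[𝕜] LocalSeries 𝕜 p d :=
  vectorField (fun v => var 𝕜 (jetParity p d) (raise μ v)) (var_raise_locallyFinite p μ)

/-- The iterated total derivative `∂_I = ∏_μ ∂_μ ^ I_μ`. -/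
def totalDerivs (p : F → ZMod 2) (I : Fin d → ℕ) : LocalSeries 𝕜 p d →ₗ[𝕜] LocalSeries 𝕜 p d :=
  (List.ofFn fun μ => (totalDeriv p μ : Module.End 𝕜 (LocalSeries 𝕜 p d)) ^ I μ).prod

/-- Series that are total derivatives, `∑_μ ∂_μ J^μ`. -/
def totalDivergences (𝕜 : Type*) [Field 𝕜] (p : F → ZMod 2) (d : ℕ) :
    Submodule 𝕜 (LocalSeries 𝕜 p d) :=
  ⨆ μ : Fin d, LinearMap.range (totalDeriv p μ)

/-- Integrated local formal power series: `∫ X` is the class of the density `X` modulo total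
derivatives. -/
abbrev Functional (𝕜 : Type*) [Field 𝕜] (p : F → ZMod 2) (d : ℕ) : Type _ :=
  LocalSeries 𝕜 p d ⧸ totalDivergences 𝕜 p d

/-- The map `X ↦ ∫ X`. -/
def integral (𝕜 : Type*) [Field 𝕜] (p : F → ZMod 2) (d : ℕ) : LocalSeries 𝕜 p d →ₗ[𝕜] Functional 𝕜 p d :=
  (totalDivergences 𝕜 p d).mkQ

/-! Helper facts on total derivatives. -/

/-- The inverse of `raise μ` on the jet variables with a positive number of derivatives `∂_μ`. -/
def lower (μ : Fin d) (v : Jet F d) : Jet F d := (v.1, v.2 - Pi.single μ 1)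

/-- The Taylor coefficients of a total derivative, by recursion on the word. -/
def rawD (μ : Fin d) : (List (Jet F d) → 𝕜) → List (Jet F d) → 𝕜
  | _, [] => 0
  | X, v :: l => rawD μ (fun m => X (v :: m)) l
      + if v.2 μ = 0 then 0 else X (lower μ v :: l)

theorem raise_lower (μ : Fin d) (u : Jet F d) (h : u.2 μ ≠ 0) :
    raise μ (lower μ u) = u := by
  refine Prod.ext rfl ?_
  funext ν
  by_cases hν : ν = μ
  · subst hν; simp [raise, lower]; omega
  · simp [raise, lower, hν]

theorem lower_raise (μ : Fin d) (v : Jet F d) :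
    lower μ (raise μ v) = v := by
  refine Prod.ext rfl ?_
  simp [raise, lower]

theorem raise_apply_ne (μ : Fin d) (v : Jet F d) : (raise μ v).2 μ ≠ 0 := by
  simp [raise]

open Classical in
theorem rawMul_one_left (p : Jet F d → ZMod 2) (l : List (Jet F d)) (c : 𝕜)
    (Y : List (Jet F d) → 𝕜) : rawMul p (fun m => if m = [] then c else 0) Y l = c * Y l := by
  induction l generalizing Y with
  | nil => simp [rawMul]
  | cons v l ih =>
    have h0 : ∀ l, rawMul p (fun _ => (0 : 𝕜)) Y l = 0 := fun l => by
      have := rawMul_smul_left p l (0 : 𝕜) (fun _ => 0) Y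
      simpa using this
    have h1 : (fun m => koszul 𝕜 (p v) (wordParity p m) * (if m = [] then c else 0))
        = fun m : List (Jet F d) => if m = [] then c else 0 := by
      funext m
      split_ifs with h
      · subst h; simp [wordParity, koszul_zero]
      · simp
    simp only [rawMul, List.cons_ne_nil, if_false, h0, h1, ih, zero_add]

theorem totalDeriv_apply (p : F → ZMod 2) (μ : Fin d) (X : LocalSeries 𝕜 p d)
    (l : List (Jet F d)) : (totalDeriv p μ X).1 l = rawD μ X.1 l := by
  classical
  induction l generalizing X with
  | nil =>
    show ∑ᶠ v, rawMul (jetParity p d) (var 𝕜 (jetParity p d) (raise μ v)).1 _ [] = 0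
    simp [rawMul, var]
  | cons u l ih =>
    have hterm : ∀ v, rawMul (jetParity p d) (var 𝕜 (jetParity p d) (raise μ v)).1
        (pderiv v X).1 (u :: l)
        = (if u = raise μ v then X.1 (v :: l) else 0)
          + rawMul (jetParity p d) (var 𝕜 (jetParity p d) (raise μ v)).1
            (pderiv v (pderiv u X)).1 l := by
      intro v
      have e1 : (fun m => (var 𝕜 (jetParity p d) (raise μ v)).1 (u :: m))
          = fun m => if m = [] then (if u = raise μ v then (1 : 𝕜) else 0) else 0 := by
        funext m
        simp only [var, List.cons.injEq]
        split_ifs <;> simp_all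
      have e2 : (fun m => koszul 𝕜 (jetParity p d u) (wordParity (jetParity p d) m)
            * (var 𝕜 (jetParity p d) (raise μ v)).1 m)
          = fun m => koszul 𝕜 (jetParity p d u) (jetParity p d v)
            * (var 𝕜 (jetParity p d) (raise μ v)).1 m := by
        funext m
        simp only [var]
        split_ifs with h
        · subst h; simp [wordParity, jetParity, raise]
        · simp
      have e3 : (fun m => (pderiv v X).1 (u :: m))
          = fun m => koszul 𝕜 (jetParity p d u) (jetParity p d v)
            * (pderiv v (pderiv u X)).1 m := by
        funext m
        rw [koszul_comm]
        exact X.2 [] v u m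
      rw [rawMul, e1, e2, e3, rawMul_one_left, rawMul_smul_left, rawMul_smul_right,
        ← mul_assoc, koszul_mul_self, one_mul]
      congr 1
      simp [pderiv]
    have hsum : ∑ᶠ v, (if u = raise μ v then X.1 (v :: l) else 0)
        = if u.2 μ = 0 then 0 else X.1 (lower μ u :: l) := by
      split_ifs with h
      · refine finsum_eq_zero_of_forall_eq_zero fun v => if_neg fun hv => ?_
        exact raise_apply_ne μ v (by rw [← hv]; exact h)
      · rw [finsum_eq_single _ (lower μ u), raise_lower μ u h,
          if_pos rfl]
        intro v hv
        refine if_neg fun h' => hv ?_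
        rw [h', lower_raise]
    show ∑ᶠ v, rawMul (jetParity p d) (var 𝕜 (jetParity p d) (raise μ v)).1
        (pderiv v X).1 (u :: l) = _
    simp only [hterm]
    rw [finsum_add_distrib, hsum, rawD, add_comm]
    · congr 1
      exact ih (pderiv u X)
    · by_cases h : u.2 μ = 0
      · refine Set.Finite.subset Set.finite_empty fun v hv => ?_
        refine hv (if_neg fun h' => raise_apply_ne μ v (by rw [← h']; exact h))
      · refine (Set.finite_singleton (lower μ u)).subset fun v hv => ?_
        by_contra hne
        refine hv (if_neg fun h' => hne ?_)
        rw [h', lower_raise]; rfl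
    · exact (var_raise_locallyFinite p μ).finite_support _ l

theorem rawD_add (μ : Fin d) (l : List (Jet F d)) (X Y : List (Jet F d) → 𝕜) :
    rawD μ (fun m => X m + Y m) l = rawD μ X l + rawD μ Y l := by
  induction l generalizing X Y with
  | nil => simp [rawD]
  | cons v l ih => simp only [rawD, ih]; split_ifs <;> ring

theorem rawD_zero (μ : Fin d) (l : List (Jet F d)) : rawD μ (fun _ => (0 : 𝕜)) l = 0 := by
  induction l with
  | nil => simp [rawD]
  | cons v l ih => simp [rawD, ih]

/-- `∂_μ` commutes with rescalings of monomials that depend only on the fields they contain. -/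
theorem rawD_weight (μ : Fin d) (l : List (Jet F d)) (ω : List F → 𝕜)
    (X : List (Jet F d) → 𝕜) :
    rawD μ (fun m => ω (m.map Prod.fst) * X m) l = ω (l.map Prod.fst) * rawD μ X l := by
  induction l generalizing ω X with
  | nil => simp [rawD]
  | cons v l ih =>
    simp only [rawD, List.map_cons, mul_add, mul_ite, mul_zero]
    rw [ih (fun m => ω (v.1 :: m)) (fun m => X (v :: m))]
    rfl

theorem rawD_twist (p : F → ZMod 2) (μ : Fin d) (e : ZMod 2) (X : List (Jet F d) → 𝕜) :
    rawD μ (fun m => koszul 𝕜 e (wordParity (jetParity p d) m) * X m)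
      = fun l => koszul 𝕜 e (wordParity (jetParity p d) l) * rawD μ X l := by
  funext l
  have h : ∀ m : List (Jet F d), wordParity (jetParity p d) m = wordParity p (m.map Prod.fst) := by
    intro m; simp only [wordParity, List.map_map]; rfl
  simp only [h]
  exact rawD_weight μ l (fun m => koszul 𝕜 e (wordParity p m)) X

theorem rawD_rawMul (p : F → ZMod 2) (μ : Fin d) (l : List (Jet F d))
    (X Y : List (Jet F d) → 𝕜) :
    rawD μ (rawMul (jetParity p d) X Y) l
      = rawMul (jetParity p d) (rawD μ X) Y l + rawMul (jetParity p d) X (rawD μ Y) l := by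
  induction l generalizing X Y with
  | nil => simp [rawMul, rawD]
  | cons v l ih =>
    have hl : ∀ Z W : List (Jet F d) → 𝕜,
        (if v.2 μ = 0 then 0 else rawMul (jetParity p d) Z W (lower μ v :: l))
        = rawMul (jetParity p d)
            (fun m => if v.2 μ = 0 then 0 else Z (lower μ v :: m)) W l
          + rawMul (jetParity p d) (fun m => koszul 𝕜 (jetParity p d v)
              (wordParity (jetParity p d) m) * Z m)
            (fun m => if v.2 μ = 0 then 0 else W (lower μ v :: m)) l := by
      intro Z W
      split_ifs with h
      · have h1 := rawMul_smul_left (jetParity p d) l (0 : 𝕜) (fun _ => 0) W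
        have h2 := rawMul_smul_right (jetParity p d) l (0 : 𝕜) (fun m => koszul 𝕜 (jetParity p d v)
              (wordParity (jetParity p d) m) * Z m) (fun _ => 0)
        simp only [mul_zero, zero_mul] at h1 h2
        rw [h1, h2, add_zero]
      · rfl
    rw [rawD, hl]
    simp only [rawMul]
    rw [rawD_add, ih, ih, rawD_twist]
    simp only [rawD, rawMul_add_left, rawMul_add_right]
    ring

theorem rawD_comm (μ ν : Fin d) (l : List (Jet F d)) (X : List (Jet F d) → 𝕜) :
    rawD μ (rawD ν X) l = rawD ν (rawD μ X) l := by
  induction l generalizing X with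
  | nil => simp [rawD]
  | cons v l ih =>
    have key : ∀ ρ σ : Fin d, rawD ρ (rawD σ X) (v :: l)
        = rawD ρ (rawD σ (fun m => X (v :: m))) l
          + (if v.2 σ = 0 then 0 else rawD ρ (fun m => X (lower σ v :: m)) l)
          + (if v.2 ρ = 0 then 0 else rawD σ (fun m => X (lower ρ v :: m)) l)
          + (if v.2 ρ = 0 then 0 else if (lower ρ v).2 σ = 0 then 0 else
              X (lower σ (lower ρ v) :: l)) := by
      intro ρ σ
      have h : rawD ρ (fun m => if v.2 σ = 0 then 0 else X (lower σ v :: m)) l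
          = if v.2 σ = 0 then 0 else rawD ρ (fun m => X (lower σ v :: m)) l := by
        split_ifs
        · exact rawD_zero ρ l
        · rfl
      rw [rawD]
      simp only [rawD]
      rw [rawD_add, h]
      split_ifs <;> ring
    rw [key, key, ih]
    by_cases hμν : μ = ν
    · subst hμν; rfl
    · have h1 : (lower μ v).2 ν = v.2 ν := by simp [lower, Ne.symm hμν]
      have h2 : (lower ν v).2 μ = v.2 μ := by simp [lower, hμν]
      have h3 : lower ν (lower μ v) = lower μ (lower ν v) := by
        simp [lower, tsub_right_comm]
      rw [h1, h2, h3]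
      split_ifs <;> ring

theorem prod_ofFn_pow {M : Type*} [Monoid M] {n : ℕ} (f : Fin n → M)
    (hf : ∀ i j, Commute (f i) (f j)) (I : Fin n → ℕ) (i : Fin n) :
    (List.ofFn fun j => f j ^ (I + Pi.single i 1 : Fin n → ℕ) j).prod
      = f i * (List.ofFn fun j => f j ^ I j).prod := by
  induction n with
  | zero => exact i.elim0
  | succ n ih =>
    rw [List.ofFn_succ, List.ofFn_succ, List.prod_cons, List.prod_cons]
    refine Fin.cases ?_ (fun k => ?_) i
    · simp [pow_succ', mul_assoc]
    · have h := ih (fun j => f j.succ) (fun _ _ => hf _ _) (fun j => I j.succ) k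
      have e : (fun j : Fin n => f j.succ ^ (I + Pi.single k.succ 1 : Fin (n + 1) → ℕ) j.succ)
          = fun j => f j.succ ^ ((fun j => I j.succ) + Pi.single k 1 : Fin n → ℕ) j := by
        funext j
        by_cases hj : j = k
        · subst hj; simp
        · simp [hj]
      rw [e, h]
      have h0 : (I + Pi.single k.succ 1 : Fin (n + 1) → ℕ) 0 = I 0 := by simp [(Fin.succ_ne_zero k).symm]
      rw [h0, ← mul_assoc, ← mul_assoc]
      rw [((hf 0 k.succ).pow_left (I 0)).eq]

theorem totalDeriv_val (p : F → ZMod 2) (μ : Fin d) (X : LocalSeries 𝕜 p d) :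
    (totalDeriv p μ X).1 = rawD μ X.1 := funext (totalDeriv_apply p μ X)

theorem totalDerivs_raise (p : F → ZMod 2) (μ : Fin d) (I : Fin d → ℕ) (X : LocalSeries 𝕜 p d) :
    totalDerivs p (I + Pi.single μ 1) X = totalDeriv p μ (totalDerivs p I X) := by
  unfold totalDerivs
  rw [prod_ofFn_pow]
  · rfl
  · intro i j
    refine LinearMap.ext fun X => Subtype.ext ?_
    show (totalDeriv p i (totalDeriv p j X)).1 = (totalDeriv p j (totalDeriv p i X)).1
    rw [totalDeriv_val, totalDeriv_val, totalDeriv_val, totalDeriv_val]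
    exact funext fun l => rawD_comm i j l X.1

theorem totalDerivs_zero (p : F → ZMod 2) (X : LocalSeries 𝕜 p d) :
    totalDerivs p 0 X = X := by
  have : (List.ofFn fun μ : Fin d =>
      (totalDeriv p μ : Module.End 𝕜 (LocalSeries 𝕜 p d)) ^ (0 : Fin d → ℕ) μ).prod = 1 := by
    apply List.prod_eq_one
    intro x hx
    obtain ⟨i, rfl⟩ := (List.mem_ofFn' _ _).1 hx
    simp
  simp only [totalDerivs, this]
  rfl

theorem sum_add_single (I : Fin d → ℕ) (μ : Fin d) :
    ∑ ν, (I + Pi.single μ 1 : Fin d → ℕ) ν = ∑ ν, I ν + 1 := by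
  simp [Finset.sum_add_distrib]

/-- Induction on multi-indices. -/
theorem multiIndex_induction {P : (Fin d → ℕ) → Prop} (h0 : P 0)
    (h1 : ∀ I μ, P I → P (I + Pi.single μ 1)) (I : Fin d → ℕ) : P I := by
  induction hn : ∑ μ, I μ generalizing I with
  | zero =>
    have : I = 0 := by
      funext μ
      simpa using (Finset.sum_eq_zero_iff.1 hn) μ (Finset.mem_univ _)
    exact this ▸ h0
  | succ n ih =>
    obtain ⟨μ, hμ⟩ : ∃ μ, I μ ≠ 0 := by
      by_contra h
      push Not at h
      simp [h] at hn
    have hI : I = (I - Pi.single μ 1) + Pi.single μ 1 := by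
      funext ν
      by_cases hν : ν = μ
      · subst hν; simp; omega
      · simp [hν]
    rw [hI]
    refine h1 _ _ (ih _ ?_)
    have h2 := sum_add_single (I - Pi.single μ 1) μ
    rw [← hI] at h2
    omega

/-- The number of derivatives in a monomial. -/
def wordOrder (l : List (Jet F d)) : ℕ := (l.map fun v => ∑ μ, v.2 μ).sum

theorem totalDeriv_support (p : F → ZMod 2) (μ : Fin d) (X : LocalSeries 𝕜 p d)
    (l : List (Jet F d)) (h : (totalDeriv p μ X).1 l ≠ 0) :
    ∃ v l₂, (raise μ v :: l₂).Perm l ∧ X.1 (v :: l₂) ≠ 0 := by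
  obtain ⟨v, hv⟩ := exists_of_finsum_ne_zero h
  obtain ⟨l₁, l₂, hp, h1, h2⟩ := rawMul_support _ l _ _ hv
  have : l₁ = [raise μ v] := by
    by_contra hne
    exact h1 (if_neg hne)
  subst this
  exact ⟨v, l₂, hp, h2⟩

theorem totalDerivs_order (p : F → ZMod 2) (X : LocalSeries 𝕜 p d) (I : Fin d → ℕ)
    (l : List (Jet F d)) (h : (totalDerivs p I X).1 l ≠ 0) : ∑ μ, I μ ≤ wordOrder l := by
  induction I using multiIndex_induction generalizing l with
  | h0 => simp
  | h1 I μ ih =>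
    rw [totalDerivs_raise] at h
    obtain ⟨v, l₂, hp, h2⟩ := totalDeriv_support p μ _ l h
    have h3 := ih _ h2
    have h4 : wordOrder l = wordOrder (raise μ v :: l₂) := ((hp.map _).sum_eq).symm
    rw [h4]
    simp only [wordOrder, List.map_cons, List.sum_cons, raise, sum_add_single] at h3 ⊢
    omega

theorem prolongation_locallyFinite [Finite F] {p : F → ZMod 2} (g : F → LocalSeries 𝕜 p d) :
    LocallyFinite fun v : Jet F d => totalDerivs p v.2 (g v.1) := by
  intro l
  have hfin : (Set.univ ×ˢ Set.Iic (fun _ => wordOrder l) : Set (Jet F d)).Finite :=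
    Set.finite_univ.prod (Set.finite_Iic _)
  refine hfin.subset ?_
  rintro v ⟨l₁, l₂, hp, h⟩
  refine ⟨trivial, fun μ => ?_⟩
  have h1 := totalDerivs_order p _ _ _ h
  have h2 : wordOrder l = wordOrder l₁ + wordOrder l₂ := by
    rw [wordOrder, ← (hp.map _).sum_eq]; simp [wordOrder]
  have h3 : v.2 μ ≤ ∑ μ, v.2 μ := Finset.single_le_sum (fun _ _ => Nat.zero_le _) (Finset.mem_univ μ)
  show v.2 μ ≤ wordOrder l
  omega

/-- The operator `∑_{a, I} (∂_I g_a) ∂/∂(∂_I a)` on densities: the derivation that commutes with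
the `∂_μ` and maps the field `a` to `g a`. -/
def evolution [Finite F] {p : F → ZMod 2} (g : F → LocalSeries 𝕜 p d) :
    LocalSeries 𝕜 p d →ₗ[𝕜] LocalSeries 𝕜 p d :=
  vectorField (fun v => totalDerivs p v.2 (g v.1)) (prolongation_locallyFinite g)

theorem rawD_finite_support {ι : Type*} (μ : Fin d) (l : List (Jet F d))
    (f : ι → List (Jet F d) → 𝕜) (hf : ∀ m, (Function.support fun i => f i m).Finite) :
    (Function.support fun i => rawD μ (f i) l).Finite := by
  induction l generalizing f with
  | nil => simp [rawD]
  | cons v l ih =>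
    simp only [rawD]
    refine ((ih _ fun m => hf (v :: m)).union (hf (lower μ v :: l))).subset ?_
    intro i hi
    by_contra hne
    simp only [Set.mem_union, Function.mem_support, not_or, not_not] at hne
    exact hi (by simp [hne.1, hne.2])

theorem rawD_finsum {ι : Type*} (μ : Fin d) (l : List (Jet F d))
    (f : ι → List (Jet F d) → 𝕜) (hf : ∀ m, (Function.support fun i => f i m).Finite) :
    rawD μ (fun m => ∑ᶠ i, f i m) l = ∑ᶠ i, rawD μ (f i) l := by
  induction l generalizing f with
  | nil => simp [rawD]
  | cons v l ih =>
    simp only [rawD]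
    rw [ih _ fun m => hf (v :: m), finsum_add_distrib]
    · congr 1
      split_ifs <;> simp
    · exact rawD_finite_support μ l _ fun m => hf (v :: m)
    · split_ifs
      · exact Set.finite_empty.subset fun i hi => hi rfl
      · exact hf _

theorem evolution_totalDeriv [Finite F] {p : F → ZMod 2} (g : F → LocalSeries 𝕜 p d) (μ : Fin d)
    (X : LocalSeries 𝕜 p d) :
    evolution g (totalDeriv p μ X) = totalDeriv p μ (evolution g X) := by
  refine Subtype.ext (funext fun l => ?_)
  rw [totalDeriv_apply]
  set Q : Jet F d → LocalSeries 𝕜 p d := fun v => totalDerivs p v.2 (g v.1) with hQdef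
  have hQ : LocallyFinite Q := prolongation_locallyFinite g
  have hQr : ∀ v, rawD μ (Q v).1 = (Q (raise μ v)).1 := by
    intro v
    rw [← totalDeriv_val]
    simp only [hQdef, raise, totalDerivs_raise]
  have hL : ∀ v, rawMul (jetParity p d) (Q v).1 (pderiv v (totalDeriv p μ X)).1 l
      = rawMul (jetParity p d) (Q v).1 (rawD μ (pderiv v X).1) l
        + rawMul (jetParity p d) (Q v).1
          (fun m => if v.2 μ = 0 then 0 else X.1 (lower μ v :: m)) l := by
    intro v
    rw [← rawMul_add_right]
    congr 1
    funext m
    show (totalDeriv p μ X).1 (v :: m) = _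
    rw [totalDeriv_apply]
    rfl
  show ∑ᶠ v, rawMul (jetParity p d) (Q v).1 (pderiv v (totalDeriv p μ X)).1 l
    = rawD μ (fun m => ∑ᶠ v, rawMul (jetParity p d) (Q v).1 (pderiv v X).1 m) l
  rw [rawD_finsum μ l (fun v m => rawMul (jetParity p d) (Q v).1 (pderiv v X).1 m)
    (fun m => hQ.finite_support _ m)]
  have hR : ∀ v, rawD μ (fun m => rawMul (jetParity p d) (Q v).1 (pderiv v X).1 m) l
      = rawMul (jetParity p d) (Q (raise μ v)).1 (pderiv v X).1 l
        + rawMul (jetParity p d) (Q v).1 (rawD μ (pderiv v X).1) l := by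
    intro v
    rw [← hQr]
    exact rawD_rawMul p μ l _ _
  simp only [hL, hR]
  have hfin : (Function.support fun v =>
      rawMul (jetParity p d) (Q (raise μ v)).1 (pderiv v X).1 l).Finite := by
    refine ((hQ l).preimage (raise_injective μ).injOn).subset fun v hv => ?_
    obtain ⟨l₁, l₂, h, h1, -⟩ := rawMul_support _ l _ _ hv
    exact ⟨l₁, l₂, h, h1⟩
  rw [finsum_add_distrib (hQ.finite_support _ l) (hQ.finite_support _ l),
    finsum_add_distrib hfin (hQ.finite_support _ l), add_comm]
  congr 1
  set f : Jet F d → 𝕜 := fun v => rawMul (jetParity p d) (Q v).1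
          (fun m => if v.2 μ = 0 then 0 else X.1 (lower μ v :: m)) l with hf
  have h1 : ∀ v, rawMul (jetParity p d) (Q (raise μ v)).1 (pderiv v X).1 l = f (raise μ v) := by
    intro v
    simp only [hf, if_neg (raise_apply_ne μ v), lower_raise]
    rfl
  have h2 : Function.support f ⊆ Set.range (raise μ) := by
    intro v hv
    by_cases h : v.2 μ = 0
    · exfalso
      apply hv
      simp only [hf, h, if_true]
      have := rawMul_smul_right (jetParity p d) l (0 : 𝕜) (Q v).1 (fun _ => 0)
      simpa using this
    · exact ⟨_, raise_lower μ v h⟩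
  simp only [h1]
  rw [← finsum_mem_range (raise_injective μ), ← finsum_mem_univ f]
  refine finsum_mem_inter_support_eq f _ _ ?_
  rw [Set.univ_inter, Set.inter_eq_right.2 h2]

theorem totalDivergences_le_comap (p : F → ZMod 2) (T : LocalSeries 𝕜 p d →ₗ[𝕜] LocalSeries 𝕜 p d)
    (hT : ∀ μ X, T (totalDeriv p μ X) = totalDeriv p μ (T X)) :
    totalDivergences 𝕜 p d ≤ (totalDivergences 𝕜 p d).comap T := by
  refine iSup_le fun μ => ?_
  rintro _ ⟨X, rfl⟩
  show T (totalDeriv p μ X) ∈ totalDivergences 𝕜 p d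
  rw [hT]
  exact Submodule.mem_iSup_of_mem μ ⟨_, rfl⟩

/-- The operator `∑_a ∫ g_a δ/δa` on integrated functionals,
`∫ X ↦ ∫ ∑_{a, I} (∂_I g_a) ∂X/∂(∂_I a)`. -/
def functionalEvolution [Finite F] {p : F → ZMod 2} (g : F → LocalSeries 𝕜 p d) :
    Functional 𝕜 p d →ₗ[𝕜] Functional 𝕜 p d :=
  (totalDivergences 𝕜 p d).mapQ (totalDivergences 𝕜 p d) (evolution g)
    (totalDivergences_le_comap p _ (evolution_totalDeriv g))

end Jets

/-! ### Doublets -/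

section Doublets

variable {𝕜 : Type*} [Field 𝕜] {Φ K : Type*} {d : ℕ}

/-- The fields: `φ_i`, and the doublets `(z_k, w_k)`. -/
inductive Fields (Φ K : Type*) : Type _
  | phi (i : Φ) : Fields Φ K
  | z (k : K) : Fields Φ K
  | w (k : K) : Fields Φ K

instance [Finite Φ] [Finite K] : Finite (Fields Φ K) := by
  refine Finite.of_surjective (α := Φ ⊕ K ⊕ K)
    (Sum.elim Fields.phi (Sum.elim Fields.z Fields.w)) ?_
  rintro (i | k | k)
  · exact ⟨Sum.inl i, rfl⟩
  · exact ⟨Sum.inr (Sum.inl k), rfl⟩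
  · exact ⟨Sum.inr (Sum.inr k), rfl⟩

/-- The Grassmann parities: `ε i` for `φ_i`, `η k` for `z_k`, and the opposite one for `w_k`. -/
def parity (ε : Φ → ZMod 2) (η : K → ZMod 2) : Fields Φ K → ZMod 2
  | .phi i => ε i
  | .z k => η k
  | .w k => η k + 1

/-- The number of doublet fields among `φ_i`, `z_k` and `w_k`, respectively. -/
def fieldDegree : Fields Φ K → ℕ
  | .phi _ => 0
  | .z _ => 1
  | .w _ => 1

/-- The eigenvalue of the counting operator of the doublets on a monomial: its number of factors
that are derivatives of a `z_k` or a `w_k`. -/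
def doubletDegree (l : List (Jet (Fields Φ K) d)) : ℕ := (l.map fun v => fieldDegree v.1).sum

/-- The component of degree `j` of a local formal power series. -/
def component {p : Fields Φ K → ZMod 2} (j : ℕ) : LocalSeries 𝕜 p d →ₗ[𝕜] LocalSeries 𝕜 p d where
  toFun X := ⟨fun l => if doubletDegree l = j then X.1 l else 0, by
    intro l u v l'
    have : doubletDegree (l ++ u :: v :: l') = doubletDegree (l ++ v :: u :: l') := by
      simp [doubletDegree]; omega
    simp only [this, X.2 l u v l', mul_ite, mul_zero]⟩
  map_add' X Y := by
    ext l
    show (if _ then X.1 l + Y.1 l else 0) = (if _ then X.1 l else 0) + (if _ then Y.1 l else 0)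
    split_ifs <;> simp
  map_smul' c X := by
    ext l
    show (if _ then c * X.1 l else 0) = c * (if _ then X.1 l else 0)
    split_ifs <;> simp

theorem component_totalDeriv {p : Fields Φ K → ZMod 2} (j : ℕ) (μ : Fin d)
    (X : LocalSeries 𝕜 p d) :
    component j (totalDeriv p μ X) = totalDeriv p μ (component j X) := by
  refine Subtype.ext (funext fun l => ?_)
  rw [totalDeriv_apply]
  have h : ∀ m : List (Jet (Fields Φ K) d),
      doubletDegree m = ((m.map Prod.fst).map fieldDegree).sum := by
    intro m; simp only [doubletDegree, List.map_map]; rfl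
  have h2 := rawD_weight (𝕜 := 𝕜) μ l
    (fun m => if (m.map fieldDegree).sum = j then 1 else 0) X.1
  simp only [← h, ite_mul, one_mul, zero_mul] at h2
  rw [← totalDeriv_apply p] at h2
  exact h2.symm

/-- The component of degree `j` of an integrated functional. -/
def functionalComponent (𝕜 : Type*) [Field 𝕜] (p : Fields Φ K → ZMod 2) (d : ℕ) (j : ℕ) :
    Functional 𝕜 p d →ₗ[𝕜] Functional 𝕜 p d :=
  (totalDivergences 𝕜 p d).mapQ (totalDivergences 𝕜 p d) (component j)
    (totalDivergences_le_comap p _ (component_totalDeriv j))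

/-- The local formal power series in the `φ_i` and their derivatives only. -/
def independentSeries (𝕜 : Type*) [Field 𝕜] (p : Fields Φ K → ZMod 2) (d : ℕ) :
    Submodule 𝕜 (LocalSeries 𝕜 p d) where
  carrier := {X | ∀ l, doubletDegree l ≠ 0 → X.1 l = 0}
  zero_mem' := fun _ _ => rfl
  add_mem' := by
    intro X Y hX hY l hl
    show X.1 l + Y.1 l = 0
    rw [hX l hl, hY l hl, add_zero]
  smul_mem' := by
    intro c X hX l hl
    show c * X.1 l = 0
    rw [hX l hl, mul_zero]

/-- The space `Σ⁽⁰⁾` of integrated local formal power series in the `φ_i` and their derivatives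
only. -/
def independentFunctionals (𝕜 : Type*) [Field 𝕜] (p : Fields Φ K → ZMod 2) (d : ℕ) :
    Submodule 𝕜 (Functional 𝕜 p d) :=
  (independentSeries 𝕜 p d).map (integral 𝕜 p d)

theorem component_zero_mem {p : Fields Φ K → ZMod 2} (X : LocalSeries 𝕜 p d) :
    component 0 X ∈ independentSeries 𝕜 p d := fun _ hl => if_neg hl

theorem functionalComponent_zero_mem {p : Fields Φ K → ZMod 2} (x : Functional 𝕜 p d) :
    functionalComponent 𝕜 p d 0 x ∈ independentFunctionals 𝕜 p d := by
  obtain ⟨X, rfl⟩ := Submodule.Quotient.mk_surjective _ x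
  exact ⟨component 0 X, component_zero_mem X, rfl⟩

/-- The component of degree `0` of an integrated functional, as an element of `Σ⁽⁰⁾`. -/
def degreeZero (𝕜 : Type*) [Field 𝕜] (p : Fields Φ K → ZMod 2) (d : ℕ) :
    Functional 𝕜 p d →ₗ[𝕜] independentFunctionals 𝕜 p d :=
  (functionalComponent 𝕜 p d 0).codRestrict _ functionalComponent_zero_mem

/-- The variation of the fields under `s`: `s φ_i = g_i`, `s z_k = w_k`, `s w_k = 0`. -/
def variation {ε : Φ → ZMod 2} {η : K → ZMod 2} (g : Φ → LocalSeries 𝕜 (parity ε η) d) :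
    Fields Φ K → LocalSeries 𝕜 (parity ε η) d
  | .phi i => g i
  | .z k => var 𝕜 (jetParity (parity ε η) d) (Fields.w k, 0)
  | .w _ => 0

/-- The differential `s = ∫ g_i δ/δφ_i + ∫ w_k δ/δz_k` on the space `Σ` of integrated local formal
power series. -/
def differential [Finite Φ] [Finite K] {ε : Φ → ZMod 2} {η : K → ZMod 2}
    (g : Φ → LocalSeries 𝕜 (parity ε η) d) :
    Functional 𝕜 (parity ε η) d →ₗ[𝕜] Functional 𝕜 (parity ε η) d :=
  functionalEvolution (variation g)

/-- The variation of the fields under `s̄⁽⁰⁾`: `φ_i ↦ g_i⁽⁰⁾`, `z_k ↦ 0`, `w_k ↦ 0`, where `g_i⁽⁰⁾`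
is the part of `g_i` that does not depend on the doublets. -/
def reducedVariation {ε : Φ → ZMod 2} {η : K → ZMod 2} (g : Φ → LocalSeries 𝕜 (parity ε η) d) :
    Fields Φ K → LocalSeries 𝕜 (parity ε η) d
  | .phi i => component 0 (g i)
  | .z _ => 0
  | .w _ => 0

theorem doubletDegree_perm {l l' : List (Jet (Fields Φ K) d)} (h : l.Perm l') :
    doubletDegree l = doubletDegree l' := (h.map _).sum_eq

theorem totalDerivs_independent {p : Fields Φ K → ZMod 2} (I : Fin d → ℕ)
    {X : LocalSeries 𝕜 p d} (hX : X ∈ independentSeries 𝕜 p d) :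
    totalDerivs p I X ∈ independentSeries 𝕜 p d := by
  induction I using multiIndex_induction with
  | h0 => rwa [totalDerivs_zero]
  | h1 I μ ih =>
    rw [totalDerivs_raise]
    intro l hl
    by_contra hne
    obtain ⟨v, l₂, hp, h2⟩ := totalDeriv_support p μ _ l hne
    rw [← doubletDegree_perm hp] at hl
    exact h2 (ih _ hl)

theorem evolution_independent [Finite Φ] [Finite K] {p : Fields Φ K → ZMod 2}
    (g : Fields Φ K → LocalSeries 𝕜 p d) (hg : ∀ a, g a ∈ independentSeries 𝕜 p d)
    {X : LocalSeries 𝕜 p d} (hX : X ∈ independentSeries 𝕜 p d) :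
    evolution g X ∈ independentSeries 𝕜 p d := by
  intro l hl
  by_contra hne
  obtain ⟨v, hv⟩ := exists_of_finsum_ne_zero hne
  obtain ⟨l₁, l₂, hp, h1, h2⟩ := rawMul_support _ l _ _ hv
  have e1 : doubletDegree l₁ = 0 := by
    by_contra h
    exact h1 (totalDerivs_independent v.2 (hg v.1) _ h)
  have e2 : doubletDegree (v :: l₂) = 0 := by
    by_contra h
    exact h2 (hX _ h)
  apply hl
  rw [← doubletDegree_perm hp]
  simp only [doubletDegree, List.map_cons, List.sum_cons, List.map_append,
    List.sum_append] at e1 e2 ⊢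
  omega

theorem reduced_mem [Finite Φ] [Finite K] {ε : Φ → ZMod 2} {η : K → ZMod 2}
    (g : Φ → LocalSeries 𝕜 (parity ε η) d) (x : Functional 𝕜 (parity ε η) d)
    (hx : x ∈ independentFunctionals 𝕜 (parity ε η) d) :
    functionalEvolution (reducedVariation g) x ∈ independentFunctionals 𝕜 (parity ε η) d := by
  obtain ⟨X, hX, rfl⟩ := hx
  refine ⟨evolution (reducedVariation g) X, evolution_independent _ ?_ hX, rfl⟩
  rintro (i | k | k)
  · exact component_zero_mem _
  · exact Submodule.zero_mem _
  · exact Submodule.zero_mem _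

/-- The operator `s̄⁽⁰⁾ = ∫ g_i⁽⁰⁾ δ/δφ_i` on `Σ⁽⁰⁾`. -/
def reducedDifferential [Finite Φ] [Finite K] {ε : Φ → ZMod 2} {η : K → ZMod 2}
    (g : Φ → LocalSeries 𝕜 (parity ε η) d) :
    independentFunctionals 𝕜 (parity ε η) d →ₗ[𝕜] independentFunctionals 𝕜 (parity ε η) d :=
  (functionalEvolution (reducedVariation g)).restrict (reduced_mem g)

end Doublets

/-! ### Cohomology -/

section Cohomology

variable {𝕜 : Type*} [Field 𝕜] {M : Type*} [AddCommGroup M] [Module 𝕜 M]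

/-- The cohomology `ker s / im s` of a nilpotent operator `s`. -/
abbrev Cohomology (s : M →ₗ[𝕜] M) : Type _ :=
  LinearMap.ker s ⧸ (LinearMap.range s).comap (LinearMap.ker s).subtype

/-- The cohomology class of an `s`-closed element. -/
def Cohomology.mk (s : M →ₗ[𝕜] M) (x : M) (hx : s x = 0) : Cohomology s :=
  Submodule.Quotient.mk ⟨x, hx⟩

end Cohomology

end

end Doublets

/-! The doublets are removed by a contracting homotopy. Let `S` be the evolutionary vector field of
the differential on densities, and `h` the one with `w_k ↦ z_k` and all other fields mapped to `0`.
The part `S₀` of `S` that preserves the number of doublet factors is given by `φ_i ↦ g_i⁽⁰⁾`,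
`z_k ↦ w_k`, `w_k ↦ 0`. Since the `g_i⁽⁰⁾` are annihilated by `h`, the anticommutator `S₀ h + h S₀`
is the counting operator of the doublets (`leading_homotopy_apply`). This rests on the fact that the
graded commutator of two vector fields is again a vector field (`vectorField_commutator`), proved by
induction on the length of the words that index the Taylor coefficients: `∂/∂u` acts on both sides as
a graded derivation, and at the constant term the second derivatives cancel.

The remaining part of `S` strictly raises the number of doublet factors, so `P = S h + h S + π`, with
`π` the projection onto the series without doublets, is an invertible diagonal operator (with
eigenvalue `1` in degree `0` and `n` in degree `n > 0`, which is where characteristic zero enters)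
plus a degree-raising one. Power series are complete for the filtration by the number of doublet
factors, so `P` is bijective on densities (`bijective_of_sub_scale_mem`). It commutes with the total
derivatives, hence is bijective on integrated functionals too. It is important to invert `P` on
densities and to use `s² = 0` only on functionals: `S` need not square to zero on densities, and
infinite sums of functionals are not available.

On functionals `π s = s̄⁽⁰⁾ π` and `π h = 0`, so `s h + h s` is bijective on `ker π`; as it commutes
with `s`, the complex `ker π` is acyclic, and `π` induces an isomorphism in cohomology
(`exists_cohomology_equiv`). -/

namespace Doublets

noncomputable section

/-! ### Vector fields on power series -/

section VectorFields

variable {𝕜 : Type*} [Field 𝕜] {V : Type*} {p : V → ZMod 2}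

theorem vectorField_apply {Q : V → Series 𝕜 p} (hQ : LocallyFinite Q) (X : Series 𝕜 p)
    (l : List V) :
    (vectorField Q hQ X).1 l = ∑ᶠ v, rawMul p (Q v).1 (fun m => X.1 (v :: m)) l := rfl

theorem vectorField_support {Q : V → Series 𝕜 p} (hQ : LocallyFinite Q) {X : Series 𝕜 p}
    {l : List V} (h : (vectorField Q hQ X).1 l ≠ 0) :
    ∃ v l₁ l₂, (l₁ ++ l₂).Perm l ∧ (Q v).1 l₁ ≠ 0 ∧ X.1 (v :: l₂) ≠ 0 := by
  obtain ⟨v, hv⟩ := exists_of_finsum_ne_zero h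
  obtain ⟨l₁, l₂, hp, h1, h2⟩ := rawMul_support _ l _ _ hv
  exact ⟨v, l₁, l₂, hp, h1, h2⟩

theorem vectorField_add_left {Q Q' : V → Series 𝕜 p} (hQ : LocallyFinite Q)
    (hQ' : LocallyFinite Q') (h : LocallyFinite fun v => Q v + Q' v) (X : Series 𝕜 p) :
    vectorField (fun v => Q v + Q' v) h X = vectorField Q hQ X + vectorField Q' hQ' X := by
  refine Subtype.ext (funext fun l => ?_)
  show ∑ᶠ v, rawMul p (fun m => (Q v).1 m + (Q' v).1 m) (fun m => X.1 (v :: m)) l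
    = ∑ᶠ v, rawMul p (Q v).1 (fun m => X.1 (v :: m)) l
      + ∑ᶠ v, rawMul p (Q' v).1 (fun m => X.1 (v :: m)) l
  simp only [rawMul_add_left]
  exact finsum_add_distrib (hQ.finite_support _ l) (hQ'.finite_support _ l)

theorem vectorField_smul_left {Q : V → Series 𝕜 p} (hQ : LocallyFinite Q) (c : 𝕜)
    (h : LocallyFinite fun v => c • Q v) (X : Series 𝕜 p) :
    vectorField (fun v => c • Q v) h X = c • vectorField Q hQ X := by
  refine Subtype.ext (funext fun l => ?_)
  show ∑ᶠ v, rawMul p (fun m => c * (Q v).1 m) (fun m => X.1 (v :: m)) l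
    = c * ∑ᶠ v, rawMul p (Q v).1 (fun m => X.1 (v :: m)) l
  simp only [rawMul_smul_left, mul_finsum]

theorem vectorField_congr {Q Q' : V → Series 𝕜 p} (h : Q = Q') (hQ : LocallyFinite Q)
    (hQ' : LocallyFinite Q') (X : Series 𝕜 p) : vectorField Q hQ X = vectorField Q' hQ' X := by
  subst h; rfl

theorem LocallyFinite.add {Q Q' : V → Series 𝕜 p} (hQ : LocallyFinite Q)
    (hQ' : LocallyFinite Q') : LocallyFinite fun v => Q v + Q' v := by
  intro l
  refine ((hQ l).union (hQ' l)).subset ?_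
  rintro v ⟨l₁, l₂, hp, h⟩
  by_cases h1 : (Q v).1 l₁ = 0
  · exact Or.inr ⟨l₁, l₂, hp, fun h2 => h (by
      show (Q v).1 l₁ + (Q' v).1 l₁ = 0
      rw [h1, h2, add_zero])⟩
  · exact Or.inl ⟨l₁, l₂, hp, h1⟩

theorem LocallyFinite.smul {Q : V → Series 𝕜 p} (hQ : LocallyFinite Q) (c : 𝕜) :
    LocallyFinite fun v => c • Q v := by
  intro l
  refine (hQ l).subset ?_
  rintro v ⟨l₁, l₂, hp, h⟩
  exact ⟨l₁, l₂, hp, right_ne_zero_of_mul (a := c) h⟩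

theorem LocallyFinite.pderiv {Q : V → Series 𝕜 p} (hQ : LocallyFinite Q) (u : V) :
    LocallyFinite fun v => pderiv u (Q v) := by
  intro l
  refine (hQ (u :: l)).subset ?_
  rintro v ⟨l₁, l₂, hp, h⟩
  exact ⟨u :: l₁, l₂, hp.cons u, h⟩

theorem LocallyFinite.vectorField {Q Q' : V → Series 𝕜 p} (hQ : LocallyFinite Q)
    (hQ' : LocallyFinite Q') : LocallyFinite fun v => vectorField Q hQ (Q' v) := by
  intro l
  refine ((hQ l).biUnion fun w _ => hQ' (w :: l)).subset ?_
  rintro v ⟨l₁, l₂, hp, h⟩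
  obtain ⟨w, m₁, m₂, hm, h1, h2⟩ := vectorField_support hQ h
  have hp' : (m₁ ++ (m₂ ++ l₂)).Perm l := by
    rw [← List.append_assoc]
    exact (hm.append_right l₂).trans hp
  refine Set.mem_biUnion (x := w) ⟨m₁, m₂ ++ l₂, hp', h1⟩ ⟨w :: m₂, m₁ ++ l₂, ?_, h2⟩
  exact List.Perm.cons w ((List.perm_append_comm_assoc m₂ m₁ l₂).trans hp')

theorem HasParity.pderiv {X : Series 𝕜 p} {e : ZMod 2} (hX : HasParity X e) (u : V) :
    HasParity (pderiv u X) (p u + e) := by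
  intro l hl
  refine hX (u :: l) fun h => hl ?_
  rw [← h, wordParity_cons, ← add_assoc, CharTwo.add_self_eq_zero, zero_add]

theorem wordParity_perm {l l' : List V} (h : l.Perm l') : wordParity p l = wordParity p l' :=
  (h.map p).sum_eq

theorem HasParity.vectorField {Q : V → Series 𝕜 p} (hQ : LocallyFinite Q) {e f : ZMod 2}
    (hpar : ∀ v, HasParity (Q v) (p v + e)) {X : Series 𝕜 p} (hX : HasParity X f) :
    HasParity (vectorField Q hQ X) (e + f) := by
  intro l hl
  by_contra h
  obtain ⟨v, l₁, l₂, hp, h1, h2⟩ := vectorField_support hQ h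
  apply hl
  have e1 : wordParity p l₁ = p v + e := by
    by_contra h; exact h1 (hpar v _ h)
  have e2 : wordParity p (v :: l₂) = f := by
    by_contra h; exact h2 (hX _ h)
  rw [← wordParity_perm hp, ← e2, wordParity_cons]
  simp only [wordParity, List.map_append, List.sum_append] at e1 ⊢
  rw [e1]; ring

/-- The commutator of `∂/∂u` with a vector field of parity `e`. -/
theorem vectorField_cons {Q : V → Series 𝕜 p} (hQ : LocallyFinite Q) {e : ZMod 2}
    (hpar : ∀ v, HasParity (Q v) (p v + e)) (X : Series 𝕜 p) (u : V) (l : List V) :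
    (vectorField Q hQ X).1 (u :: l)
      = (vectorField (fun v => pderiv u (Q v)) (hQ.pderiv u) X).1 l
        + koszul 𝕜 (p u) e * (vectorField Q hQ (pderiv u X)).1 l := by
  simp only [vectorField_apply, mul_finsum]
  rw [← finsum_add_distrib ((hQ.pderiv u).finite_support _ l)]
  · refine finsum_congr fun v => ?_
    rw [rawMul]
    congr 1
    have e2 : (fun m => koszul 𝕜 (p u) (wordParity p m) * (Q v).1 m)
        = fun m => koszul 𝕜 (p u) (p v + e) * (Q v).1 m := by
      funext m
      by_cases h : wordParity p m = p v + e
      · rw [h]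
      · rw [hpar v m h, mul_zero, mul_zero]
    have e3 : (fun m => X.1 (v :: u :: m))
        = fun m => koszul 𝕜 (p u) (p v) * (pderiv u X).1 (v :: m) := by
      funext m
      rw [koszul_comm]
      exact X.2 [] v u m
    rw [e2, e3, rawMul_smul_left, rawMul_smul_right, koszul_add]
    linear_combination koszul 𝕜 (p u) e *
      rawMul p (Q v).1 (fun m => (pderiv u X).1 (v :: m)) l * koszul_mul_self (𝕜 := 𝕜) (p u) (p v)
  · refine (hQ.finite_support (fun v m => (pderiv u X).1 (v :: m)) l).subset fun v hv => ?_
    exact right_ne_zero_of_mul hv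

theorem pderiv_vectorField {Q : V → Series 𝕜 p} (hQ : LocallyFinite Q) {e : ZMod 2}
    (hpar : ∀ v, HasParity (Q v) (p v + e)) (X : Series 𝕜 p) (u : V) :
    pderiv u (vectorField Q hQ X)
      = vectorField (fun v => pderiv u (Q v)) (hQ.pderiv u) X
        + koszul 𝕜 (p u) e • vectorField Q hQ (pderiv u X) :=
  Subtype.ext (funext fun l => vectorField_cons hQ hpar X u l)

theorem finsum_comm_of_finite {α β M : Type*} [AddCommMonoid M] (f : α → β → M)
    (hf : (Function.support fun ab : α × β => f ab.1 ab.2).Finite) :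
    ∑ᶠ a, ∑ᶠ b, f a b = ∑ᶠ b, ∑ᶠ a, f a b := by
  rw [← finsum_curry (fun ab : α × β => f ab.1 ab.2) hf, ← finsum_comp_equiv (Equiv.prodComm β α),
    finsum_curry]
  · rfl
  · exact hf.preimage (Equiv.prodComm β α).injective.injOn

theorem vectorField_nil {Q : V → Series 𝕜 p} (hQ : LocallyFinite Q) (X : Series 𝕜 p) :
    (vectorField Q hQ X).1 [] = ∑ᶠ v, (Q v).1 [] * X.1 [v] := rfl

/-- At the constant term, the composition of two vector fields is the vector field with the
differentiated coefficients plus a term with second derivatives. -/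
theorem vectorField_vectorField_nil {Q Q' : V → Series 𝕜 p} (hQ : LocallyFinite Q)
    (hQ' : LocallyFinite Q') {e' : ZMod 2} (hpar' : ∀ v, HasParity (Q' v) (p v + e'))
    (X : Series 𝕜 p) :
    (vectorField Q hQ (vectorField Q' hQ' X)).1 []
      = (vectorField (fun v => vectorField Q hQ (Q' v)) (hQ.vectorField hQ') X).1 []
        + ∑ᶠ v, ∑ᶠ w, (Q v).1 [] * (koszul 𝕜 (p v) e' * ((Q' w).1 [] * X.1 [v, w])) := by
  have hs : {v | (Q v).1 [] ≠ 0}.Finite :=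
    (hQ []).subset fun v hv => ⟨[], [], List.Perm.refl _, hv⟩
  have hs' : ∀ l, {v | (Q' v).1 l ≠ 0}.Finite := fun l =>
    (hQ' l).subset fun v hv => ⟨l, [], by simp, hv⟩
  rw [vectorField_nil]
  have h1 : ∀ v, (Q v).1 [] * (vectorField Q' hQ' X).1 [v]
      = (∑ᶠ w, (Q v).1 [] * ((Q' w).1 [v] * X.1 [w]))
        + ∑ᶠ w, (Q v).1 [] * (koszul 𝕜 (p v) e' * ((Q' w).1 [] * X.1 [v, w])) := by
    intro v
    rw [vectorField_cons hQ' hpar', mul_add, vectorField_nil, vectorField_nil]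
    simp only [mul_finsum]
    rfl
  simp only [h1]
  rw [finsum_add_distrib]
  · congr 1
    rw [finsum_comm_of_finite, vectorField_nil]
    · refine finsum_congr fun w => ?_
      rw [vectorField_nil, finsum_mul]
      exact finsum_congr fun v => (mul_assoc _ _ _).symm
    · refine (hs.biUnion fun v _ => (hs' [v]).image (Prod.mk v)).subset ?_
      rintro ⟨v, w⟩ h
      exact Set.mem_biUnion (x := v) (left_ne_zero_of_mul h)
        ⟨w, left_ne_zero_of_mul (right_ne_zero_of_mul h), rfl⟩
  · refine hs.subset fun v hv => ?_
    obtain ⟨w, hw⟩ := exists_of_finsum_ne_zero hv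
    exact left_ne_zero_of_mul hw
  · refine hs.subset fun v hv => ?_
    obtain ⟨w, hw⟩ := exists_of_finsum_ne_zero hv
    exact left_ne_zero_of_mul hw

/-- The graded commutator of two vector fields is a vector field: second derivatives cancel. -/
theorem vectorField_commutator_apply {Q Q' : V → Series 𝕜 p} (hQ : LocallyFinite Q)
    (hQ' : LocallyFinite Q') {e e' : ZMod 2} (hpar : ∀ v, HasParity (Q v) (p v + e))
    (hpar' : ∀ v, HasParity (Q' v) (p v + e')) (X : Series 𝕜 p) (l : List V) :
    (vectorField Q hQ (vectorField Q' hQ' X)).1 l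
        - koszul 𝕜 e e' * (vectorField Q' hQ' (vectorField Q hQ X)).1 l
      = (vectorField (fun v => vectorField Q hQ (Q' v)) (hQ.vectorField hQ') X).1 l
        - koszul 𝕜 e e' *
          (vectorField (fun v => vectorField Q' hQ' (Q v)) (hQ'.vectorField hQ) X).1 l := by
  induction l generalizing Q Q' e e' X with
  | nil =>
    have hs : {v | (Q v).1 [] ≠ 0}.Finite :=
      (hQ []).subset fun v hv => ⟨[], [], List.Perm.refl _, hv⟩
    have hs' : {v | (Q' v).1 [] ≠ 0}.Finite :=
      (hQ' []).subset fun v hv => ⟨[], [], List.Perm.refl _, hv⟩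
    have key : ∑ᶠ v, ∑ᶠ w, (Q v).1 [] * (koszul 𝕜 (p v) e' * ((Q' w).1 [] * X.1 [v, w]))
        = koszul 𝕜 e e' *
          ∑ᶠ w, ∑ᶠ v, (Q' w).1 [] * (koszul 𝕜 (p w) e * ((Q v).1 [] * X.1 [w, v])) := by
      rw [finsum_comm_of_finite]
      · simp only [mul_finsum]
        refine finsum_congr fun w => finsum_congr fun v => ?_
        by_cases hv : (Q v).1 [] = 0
        · simp [hv]
        by_cases hw : (Q' w).1 [] = 0
        · simp [hw]
        have ev : p v = e := by
          by_contra h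
          refine hv (hpar v _ fun h0 => h ?_)
          have h1 : p v + e = 0 := h0.symm
          rwa [CharTwo.add_eq_zero] at h1
        have ew : p w = e' := by
          by_contra h
          refine hw (hpar' w _ fun h0 => h ?_)
          have h1 : p w + e' = 0 := h0.symm
          rwa [CharTwo.add_eq_zero] at h1
        have hX : X.1 [v, w] = koszul 𝕜 e e' * X.1 [w, v] := by
          rw [← ev, ← ew]; exact X.2 [] v w []
        rw [hX, ev, ew, koszul_comm e' e]
        ring
      · refine (hs.prod hs').subset ?_
        rintro ⟨v, w⟩ h
        exact ⟨left_ne_zero_of_mul h,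
          left_ne_zero_of_mul (right_ne_zero_of_mul (right_ne_zero_of_mul h))⟩
    rw [vectorField_vectorField_nil hQ hQ' hpar', vectorField_vectorField_nil hQ' hQ hpar, key]
    ring
  | cons u l ih =>
    have hparu : ∀ v, HasParity (pderiv u (Q v)) (p v + (p u + e)) := fun v => by
      have := (hpar v).pderiv u
      rwa [add_left_comm] at this
    have hparu' : ∀ v, HasParity (pderiv u (Q' v)) (p v + (p u + e')) := fun v => by
      have := (hpar' v).pderiv u
      rwa [add_left_comm] at this
    have hcomp : ∀ v, HasParity (vectorField Q hQ (Q' v)) (p v + (e + e')) := fun v => by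
      have := (hpar' v).vectorField hQ hpar
      rwa [add_left_comm] at this
    have hcomp' : ∀ v, HasParity (vectorField Q' hQ' (Q v)) (p v + (e + e')) := fun v => by
      have := (hpar v).vectorField hQ' hpar'
      rwa [add_left_comm, add_comm e'] at this
    have ih1 := ih (hQ.pderiv u) hQ' hparu hpar' X
    have ih2 := ih hQ (hQ'.pderiv u) hpar hparu' X
    have ih3 := ih hQ hQ' hpar hpar' (pderiv u X)
    have split : ∀ {R R' : V → Series 𝕜 p} (hR : LocallyFinite R) (hR' : LocallyFinite R')
        {f : ZMod 2} (_ : ∀ v, HasParity (R v) (p v + f)),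
        (vectorField (fun v => pderiv u (vectorField R hR (R' v)))
            ((hR.vectorField hR').pderiv u) X).1 l
          = (vectorField (fun v => vectorField (fun w => pderiv u (R w)) (hR.pderiv u) (R' v))
              ((hR.pderiv u).vectorField hR') X).1 l
            + koszul 𝕜 (p u) f * (vectorField (fun v => vectorField R hR (pderiv u (R' v)))
              (hR.vectorField (hR'.pderiv u)) X).1 l := by
      intro R R' hR hR' f hf
      have h2 := (hR.vectorField (hR'.pderiv u)).smul (koszul 𝕜 (p u) f)
      have h1 := (hR.pderiv u).vectorField hR'
      rw [vectorField_congr (funext fun v => pderiv_vectorField hR hf (R' v) u) _ (h1.add h2),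
        vectorField_add_left h1 h2, vectorField_smul_left]
      rfl
    have addv : ∀ {R : V → Series 𝕜 p} (hR : LocallyFinite R) (Y Z : Series 𝕜 p) (c : 𝕜),
        (vectorField R hR (Y + c • Z)).1 l
          = (vectorField R hR Y).1 l + c * (vectorField R hR Z).1 l := by
      intro R hR Y Z c
      rw [map_add, map_smul]; rfl
    rw [vectorField_cons hQ hpar, vectorField_cons hQ' hpar',
      vectorField_cons (hQ.vectorField hQ') hcomp, vectorField_cons (hQ'.vectorField hQ) hcomp',
      pderiv_vectorField hQ hpar, pderiv_vectorField hQ' hpar', addv, addv,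
      split hQ hQ' hpar, split hQ' hQ hpar']
    rw [koszul_comm (p u + e) e', koszul_add, koszul_comm e' e, koszul_comm e' (p u)] at ih1
    rw [koszul_add, koszul_comm e (p u)] at ih2
    rw [koszul_add]
    have k1 := koszul_mul_self (𝕜 := 𝕜) (p u) e
    set s := koszul 𝕜 (p u) e
    set s' := koszul 𝕜 (p u) e'
    set σ := koszul 𝕜 e e'
    linear_combination ih1 + s * ih2 + s * s' * ih3
      + (σ * ((vectorField (fun v => pderiv u (Q' v)) (hQ'.pderiv u) (vectorField Q hQ X)).1 l
        - (vectorField (fun v => vectorField (fun w => pderiv u (Q' w)) (hQ'.pderiv u) (Q v))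
              ((hQ'.pderiv u).vectorField hQ) X).1 l)) * k1

theorem vectorField_commutator {Q Q' : V → Series 𝕜 p} (hQ : LocallyFinite Q)
    (hQ' : LocallyFinite Q') {e e' : ZMod 2} (hpar : ∀ v, HasParity (Q v) (p v + e))
    (hpar' : ∀ v, HasParity (Q' v) (p v + e'))
    {C : V → Series 𝕜 p} (hC : LocallyFinite C)
    (h : ∀ v, C v = vectorField Q hQ (Q' v) - koszul 𝕜 e e' • vectorField Q' hQ' (Q v))
    (X : Series 𝕜 p) :
    vectorField Q hQ (vectorField Q' hQ' X)
        - koszul 𝕜 e e' • vectorField Q' hQ' (vectorField Q hQ X) = vectorField C hC X := by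
  refine Subtype.ext (funext fun l => ?_)
  have h1 := hQ.vectorField hQ'
  have h2 := (hQ'.vectorField hQ).smul (-koszul 𝕜 e e')
  rw [vectorField_congr (Q' := fun v => vectorField Q hQ (Q' v)
      + (-koszul 𝕜 e e') • vectorField Q' hQ' (Q v))
    (funext fun v => by rw [h v, sub_eq_add_neg]; congr 1; exact (neg_smul _ _).symm) hC (h1.add h2),
    vectorField_add_left h1 h2, vectorField_smul_left (hQ'.vectorField hQ)]
  refine (vectorField_commutator_apply hQ hQ' hpar hpar' X l).trans ?_
  show _ = _ + -koszul 𝕜 e e' * _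
  ring

end VectorFields

/-! ### Evolutionary vector fields -/

section Evolutions

variable {𝕜 : Type*} [Field 𝕜] {F : Type*} {d : ℕ}

open Classical in
theorem rawMul_one_right (p : Jet F d → ZMod 2) (l : List (Jet F d)) (c : 𝕜)
    (X : List (Jet F d) → 𝕜) : rawMul p X (fun m => if m = [] then c else 0) l = c * X l := by
  induction l generalizing X with
  | nil => simp [rawMul, mul_comm]
  | cons v l ih =>
    have h0 : ∀ Y : List (Jet F d) → 𝕜, rawMul p Y (fun _ => (0 : 𝕜)) l = 0 := fun Y => by
      simpa using rawMul_smul_right p l (0 : 𝕜) Y (fun _ => 0)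
    simp only [rawMul, List.cons_ne_nil, if_false, h0, ih, add_zero]

/-- A vector field is determined by its action on the variables. -/
theorem vectorField_var {p : Jet F d → ZMod 2} {Q : Jet F d → Series 𝕜 p}
    (hQ : LocallyFinite Q) (u : Jet F d) : vectorField Q hQ (var 𝕜 p u) = Q u := by
  classical
  refine Subtype.ext (funext fun l => ?_)
  have h : ∀ v, (fun m => (var 𝕜 p u).1 (v :: m))
      = fun m => if m = [] then (if v = u then (1 : 𝕜) else 0) else 0 := by
    intro v
    funext m
    simp only [var, List.cons.injEq]
    split_ifs <;> simp_all
  rw [vectorField_apply, finsum_eq_single _ u]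
  · rw [h, rawMul_one_right, if_pos rfl, one_mul]
  · intro v hv
    rw [h, rawMul_one_right, if_neg hv, zero_mul]

theorem hasParity_var (p : Jet F d → ZMod 2) (u : Jet F d) : HasParity (var 𝕜 p u) (p u) := by
  intro l hl
  refine if_neg fun h => hl ?_
  subst h
  simp [wordParity]

/-- A diagonal linear vector field multiplies a monomial by the sum of the eigenvalues of its
factors. -/
theorem vectorField_diagonal {p : Jet F d → ZMod 2} (c : Jet F d → 𝕜)
    (hQ : LocallyFinite fun v => c v • var 𝕜 p v) (X : Series 𝕜 p) (l : List (Jet F d)) :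
    (vectorField (fun v => c v • var 𝕜 p v) hQ X).1 l = (l.map c).sum * X.1 l := by
  classical
  induction l generalizing X with
  | nil =>
    rw [vectorField_nil, List.map_nil, List.sum_nil, zero_mul]
    refine finsum_eq_zero_of_forall_eq_zero fun v => ?_
    show c v * (if [] = [v] then 1 else 0) * X.1 [v] = 0
    simp
  | cons u l ih =>
    have hpar : ∀ v, HasParity (c v • var 𝕜 p v) (p v + 0) := by
      intro v l hl
      show c v * (var 𝕜 p v).1 l = 0
      rw [hasParity_var p v l (by rwa [add_zero] at hl), mul_zero]
    have h : ∀ v, (fun m => c v * (var 𝕜 p v).1 (u :: m))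
        = fun m => if m = [] then (if v = u then c u else 0) else 0 := by
      intro v
      funext m
      simp only [var, List.cons.injEq]
      split_ifs <;> simp_all
    rw [vectorField_cons hQ hpar, ih, koszul_zero, vectorField_apply, finsum_eq_single _ u]
    · show rawMul p (fun m => c u * (var 𝕜 p u).1 (u :: m)) _ l + _ * (_ * X.1 (u :: l)) = _
      rw [h, rawMul_one_left, if_pos rfl, List.map_cons, List.sum_cons]
      ring
    · intro v hv
      show rawMul p (fun m => c v * (var 𝕜 p v).1 (u :: m)) _ l = 0
      rw [h, rawMul_one_left, if_neg hv, zero_mul]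

variable {p : F → ZMod 2}

theorem map_totalDerivs (T : LocalSeries 𝕜 p d →ₗ[𝕜] LocalSeries 𝕜 p d)
    (hT : ∀ μ X, T (totalDeriv p μ X) = totalDeriv p μ (T X)) (I : Fin d → ℕ)
    (X : LocalSeries 𝕜 p d) : T (totalDerivs p I X) = totalDerivs p I (T X) := by
  induction I using multiIndex_induction with
  | h0 => rw [totalDerivs_zero, totalDerivs_zero]
  | h1 I μ ih => rw [totalDerivs_raise, totalDerivs_raise, hT, ih]

theorem totalDerivs_var (a : F) (I : Fin d → ℕ) :
    totalDerivs p I (var 𝕜 (jetParity p d) (a, 0)) = var 𝕜 (jetParity p d) (a, I) := by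
  induction I using multiIndex_induction with
  | h0 => rw [totalDerivs_zero]
  | h1 I μ ih =>
    rw [totalDerivs_raise, ih, totalDeriv, vectorField_var]
    rfl

theorem HasParity.totalDerivs {X : LocalSeries 𝕜 p d} {e : ZMod 2} (hX : HasParity X e)
    (I : Fin d → ℕ) : HasParity (totalDerivs p I X) e := by
  induction I using multiIndex_induction with
  | h0 => rwa [totalDerivs_zero]
  | h1 I μ ih =>
    rw [totalDerivs_raise]
    intro l hl
    by_contra h
    obtain ⟨v, l₂, hp, h2⟩ := totalDeriv_support p μ _ l h
    refine h2 (ih _ fun h3 => hl ?_)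
    rw [← wordParity_perm hp, ← h3, wordParity_cons, wordParity_cons]
    rfl

variable [Finite F]

theorem evolution_support {g : F → LocalSeries 𝕜 p d} {X : LocalSeries 𝕜 p d}
    {l : List (Jet F d)} (h : (evolution g X).1 l ≠ 0) :
    ∃ v l₁ l₂, (l₁ ++ l₂).Perm l ∧ (totalDerivs p v.2 (g v.1)).1 l₁ ≠ 0 ∧ X.1 (v :: l₂) ≠ 0 :=
  vectorField_support _ h

theorem evolution_var (g : F → LocalSeries 𝕜 p d) (a : F) :
    evolution g (var 𝕜 (jetParity p d) (a, 0)) = g a := by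
  rw [evolution, vectorField_var, totalDerivs_zero]

theorem evolution_add (g g' : F → LocalSeries 𝕜 p d) (X : LocalSeries 𝕜 p d) :
    evolution (fun a => g a + g' a) X = evolution g X + evolution g' X := by
  have h := prolongation_locallyFinite g
  have h' := prolongation_locallyFinite g'
  rw [evolution, vectorField_congr (funext fun v => map_add _ _ _) _ (h.add h'),
    vectorField_add_left h h']
  rfl

/-- The anticommutator of two odd evolutionary vector fields is evolutionary. -/
theorem evolution_anticommutator {g g' c : F → LocalSeries 𝕜 p d}
    (hg : ∀ a, HasParity (g a) (p a + 1)) (hg' : ∀ a, HasParity (g' a) (p a + 1))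
    (hc : ∀ a, c a = evolution g (g' a) + evolution g' (g a)) (X : LocalSeries 𝕜 p d) :
    evolution g (evolution g' X) + evolution g' (evolution g X) = evolution c X := by
  have hk : ∀ A B : LocalSeries 𝕜 p d, A - koszul 𝕜 1 1 • B = A + B := by
    intro A B
    refine Subtype.ext (funext fun l => ?_)
    show A.1 l - koszul 𝕜 1 1 * B.1 l = A.1 l + B.1 l
    simp [koszul]
  have key := vectorField_commutator (prolongation_locallyFinite g)
    (prolongation_locallyFinite g') (e := 1) (e' := 1) (fun v => (hg v.1).totalDerivs v.2)
    (fun v => (hg' v.1).totalDerivs v.2) (prolongation_locallyFinite c) (fun v => ?_) X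
  · rw [hk] at key
    exact key
  · rw [hk, hc, map_add,
      ← map_totalDerivs (evolution g) (evolution_totalDeriv g),
      ← map_totalDerivs (evolution g') (evolution_totalDeriv g')]
    rfl

end Evolutions

/-! ### The filtration by the number of doublet factors -/

section Filtration

variable {𝕜 : Type*} [Field 𝕜] {Φ K : Type*} {d : ℕ} {p : Fields Φ K → ZMod 2}

/-- The series all of whose monomials have at least `n` doublet factors. -/
def filtration (𝕜 : Type*) [Field 𝕜] (p : Fields Φ K → ZMod 2) (d n : ℕ) :
    Submodule 𝕜 (LocalSeries 𝕜 p d) where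
  carrier := {X | ∀ l, doubletDegree l < n → X.1 l = 0}
  zero_mem' := fun _ _ => rfl
  add_mem' := by
    intro X Y hX hY l hl
    show X.1 l + Y.1 l = 0
    rw [hX l hl, hY l hl, add_zero]
  smul_mem' := by
    intro c X hX l hl
    show c * X.1 l = 0
    rw [hX l hl, mul_zero]

theorem mem_filtration_zero (X : LocalSeries 𝕜 p d) : X ∈ filtration 𝕜 p d 0 :=
  fun _ hl => absurd hl (Nat.not_lt_zero _)

theorem eq_zero_of_mem_filtration {X : LocalSeries 𝕜 p d} (h : ∀ n, X ∈ filtration 𝕜 p d n) :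
    X = 0 :=
  Subtype.ext (funext fun l => h (doubletDegree l + 1) l (Nat.lt_succ_self _))

theorem sub_component_zero_mem_filtration (X : LocalSeries 𝕜 p d) :
    X - component 0 X ∈ filtration 𝕜 p d 1 := by
  intro l hl
  show X.1 l - (if doubletDegree l = 0 then X.1 l else 0) = 0
  rw [if_pos (by omega), sub_self]

theorem component_zero_eq_zero {X : LocalSeries 𝕜 p d} (hX : X ∈ filtration 𝕜 p d 1) :
    component 0 X = 0 := by
  refine Subtype.ext (funext fun l => ?_)
  show (if doubletDegree l = 0 then X.1 l else 0) = 0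
  split_ifs with h
  · exact hX l (by omega)
  · rfl

theorem component_zero_eq_self {X : LocalSeries 𝕜 p d} (hX : X ∈ independentSeries 𝕜 p d) :
    component 0 X = X := by
  refine Subtype.ext (funext fun l => ?_)
  show (if doubletDegree l = 0 then X.1 l else 0) = X.1 l
  split_ifs with h
  · rfl
  · exact (hX l h).symm

theorem var_mem_filtration (v : Jet (Fields Φ K) d) :
    var 𝕜 (jetParity p d) v ∈ filtration 𝕜 p d (fieldDegree v.1) := by
  intro l hl
  refine if_neg fun h => ?_
  subst h
  simp [doubletDegree] at hl

theorem totalDerivs_mem_filtration {n : ℕ} (I : Fin d → ℕ) {X : LocalSeries 𝕜 p d}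
    (hX : X ∈ filtration 𝕜 p d n) : totalDerivs p I X ∈ filtration 𝕜 p d n := by
  induction I using multiIndex_induction with
  | h0 => rwa [totalDerivs_zero]
  | h1 I μ ih =>
    rw [totalDerivs_raise]
    intro l hl
    by_contra hne
    obtain ⟨v, l₂, hp, h2⟩ := totalDeriv_support p μ _ l hne
    rw [← doubletDegree_perm hp] at hl
    exact h2 (ih _ hl)

/-- If a monomial of `g a` has at least `r` doublet factors more than `a` itself, then the
evolution along `g` raises the number of doublet factors by `r`. -/
theorem evolution_mem_filtration_add [Finite Φ] [Finite K] {g : Fields Φ K → LocalSeries 𝕜 p d}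
    {r n : ℕ} (hg : ∀ a, g a ∈ filtration 𝕜 p d (fieldDegree a + r)) {X : LocalSeries 𝕜 p d}
    (hX : X ∈ filtration 𝕜 p d n) : evolution g X ∈ filtration 𝕜 p d (n + r) := by
  intro l hl
  by_contra hne
  obtain ⟨v, l₁, l₂, hp, h1, h2⟩ := evolution_support hne
  have e1 : fieldDegree v.1 + r ≤ doubletDegree l₁ := by
    by_contra h
    exact h1 (totalDerivs_mem_filtration v.2 (hg v.1) _ (by omega))
  have e2 : n ≤ doubletDegree (v :: l₂) := by
    by_contra h
    exact h2 (hX _ (by omega))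
  rw [← doubletDegree_perm hp] at hl
  simp only [doubletDegree, List.map_cons, List.sum_cons, List.map_append,
    List.sum_append] at e1 e2 hl
  omega

theorem evolution_mem_filtration [Finite Φ] [Finite K] {g : Fields Φ K → LocalSeries 𝕜 p d}
    {n : ℕ} (hg : ∀ a, g a ∈ filtration 𝕜 p d n) (X : LocalSeries 𝕜 p d) :
    evolution g X ∈ filtration 𝕜 p d n := by
  intro l hl
  by_contra hne
  obtain ⟨v, l₁, l₂, hp, h1, -⟩ := evolution_support hne
  refine h1 (totalDerivs_mem_filtration v.2 (hg v.1) _ ?_)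
  rw [← doubletDegree_perm hp] at hl
  simp only [doubletDegree, List.map_append, List.sum_append] at hl ⊢
  omega

/-- Multiplication of the monomials with `n` doublet factors by `ω n`. -/
def scale (p : Fields Φ K → ZMod 2) (d : ℕ) (ω : ℕ → 𝕜) :
    LocalSeries 𝕜 p d →ₗ[𝕜] LocalSeries 𝕜 p d where
  toFun X := ⟨fun l => ω (doubletDegree l) * X.1 l, by
    intro l u v l'
    have : doubletDegree (l ++ u :: v :: l') = doubletDegree (l ++ v :: u :: l') :=
      doubletDegree_perm ((List.Perm.swap v u l').append_left l)
    simp only [this, X.2 l u v l']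
    ring⟩
  map_add' X Y := Subtype.ext (funext fun l => mul_add _ (X.1 l) (Y.1 l))
  map_smul' c X := Subtype.ext (funext fun l => mul_left_comm _ c (X.1 l))

theorem scale_apply (ω : ℕ → 𝕜) (X : LocalSeries 𝕜 p d) (l : List (Jet (Fields Φ K) d)) :
    (scale p d ω X).1 l = ω (doubletDegree l) * X.1 l := rfl

theorem scale_mem_filtration (ω : ℕ → 𝕜) {n : ℕ} {X : LocalSeries 𝕜 p d}
    (hX : X ∈ filtration 𝕜 p d n) : scale p d ω X ∈ filtration 𝕜 p d n := by
  intro l hl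
  rw [scale_apply, hX l hl, mul_zero]

/-- Series are complete for the filtration: a sequence that stabilizes in every degree has a
limit. -/
theorem exists_limit (x : ℕ → LocalSeries 𝕜 p d)
    (hx : ∀ n, x (n + 1) - x n ∈ filtration 𝕜 p d n) :
    ∃ X, ∀ n, X - x n ∈ filtration 𝕜 p d n := by
  have hstab : ∀ l k, (x (doubletDegree l + 1 + k)).1 l = (x (doubletDegree l + 1)).1 l := by
    intro l k
    induction k with
    | zero => rfl
    | succ k ih =>
      rw [← ih]
      exact sub_eq_zero.1 (hx (doubletDegree l + 1 + k) l (by omega))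
  refine ⟨⟨fun l => (x (doubletDegree l + 1)).1 l, ?_⟩, fun n l hl => ?_⟩
  · intro l u v l'
    have : doubletDegree (l ++ u :: v :: l') = doubletDegree (l ++ v :: u :: l') :=
      doubletDegree_perm ((List.Perm.swap v u l').append_left l)
    simp only [this]
    exact (x _).2 l u v l'
  · have h := hstab l (n - (doubletDegree l + 1))
    rw [Nat.add_sub_cancel' (by omega)] at h
    exact sub_eq_zero.2 h.symm

/-- An operator that is an invertible diagonal operator up to terms that raise the number of
doublet factors is bijective. -/
theorem bijective_of_sub_scale_mem {P : LocalSeries 𝕜 p d →ₗ[𝕜] LocalSeries 𝕜 p d} {ω : ℕ → 𝕜}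
    (hω : ∀ n, ω n ≠ 0)
    (hP : ∀ n X, X ∈ filtration 𝕜 p d n → P X - scale p d ω X ∈ filtration 𝕜 p d (n + 1)) :
    Function.Bijective P := by
  constructor
  · refine (injective_iff_map_eq_zero P).2 fun X hX => eq_zero_of_mem_filtration fun n => ?_
    induction n with
    | zero => exact mem_filtration_zero X
    | succ n ih =>
      intro l hl
      have h := hP n X ih l hl
      rw [hX, zero_sub] at h
      exact (mul_eq_zero.1 (neg_eq_zero.1 h)).resolve_left (hω _)
  · intro Y
    have hinv : ∀ X, scale p d ω (scale p d (fun n => (ω n)⁻¹) X) = X := fun X =>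
      Subtype.ext (funext fun l => mul_inv_cancel_left₀ (hω _) (X.1 l))
    -- Each step corrects by the diagonal inverse of the residual `P X - Y`, which thereby moves one
    -- step up in the filtration.
    let x : ℕ → LocalSeries 𝕜 p d := fun n =>
      Nat.rec 0 (fun _ X => X - scale p d (fun n => (ω n)⁻¹) (P X - Y)) n
    have hx : ∀ n, P (x n) - Y ∈ filtration 𝕜 p d n := by
      intro n
      induction n with
      | zero => exact mem_filtration_zero _
      | succ n ih =>
        have h := hP n _ (scale_mem_filtration (fun n => (ω n)⁻¹) ih)
        rw [hinv] at h
        have e : P (x (n + 1)) - Y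
            = -(P (scale p d (fun n => (ω n)⁻¹) (P (x n) - Y)) - (P (x n) - Y)) := by
          show P (x n - scale p d (fun n => (ω n)⁻¹) (P (x n) - Y)) - Y = _
          rw [map_sub P]
          abel
        rw [e]
        exact Submodule.neg_mem _ h
    obtain ⟨X, hX⟩ := exists_limit x fun n => by
      have e : x (n + 1) - x n = -scale p d (fun n => (ω n)⁻¹) (P (x n) - Y) :=
        sub_sub_cancel_left _ _
      rw [e]
      exact Submodule.neg_mem _ (scale_mem_filtration _ (hx n))
    refine ⟨X, sub_eq_zero.1 (eq_zero_of_mem_filtration fun n => ?_)⟩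
    have hle : filtration 𝕜 p d (n + 1) ≤ filtration 𝕜 p d n := fun Z hZ l hl =>
      hZ l (Nat.lt_succ_of_lt hl)
    have h := Submodule.add_mem _ (Submodule.add_mem _ (hle (hP n _ (hX n)))
      (scale_mem_filtration ω (hX n))) (hx n)
    rwa [sub_add_cancel, map_sub, sub_add_sub_cancel] at h

end Filtration

/-! ### The homotopy -/

section Homotopy

variable {𝕜 : Type*} [Field 𝕜] {Φ K : Type*} {d : ℕ} {ε : Φ → ZMod 2} {η : K → ZMod 2}

/-- The part `φ_i ↦ g_i⁽⁰⁾`, `z_k ↦ w_k`, `w_k ↦ 0` of the variation of the fields that preserves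
the number of doublet factors. -/
def leadingVariation (g : Φ → LocalSeries 𝕜 (parity ε η) d) :
    Fields Φ K → LocalSeries 𝕜 (parity ε η) d
  | .phi i => component 0 (g i)
  | .z k => var 𝕜 (jetParity (parity ε η) d) (Fields.w k, 0)
  | .w _ => 0

/-- The part `φ_i ↦ g_i - g_i⁽⁰⁾`, `z_k ↦ 0`, `w_k ↦ 0` of the variation of the fields that raises
the number of doublet factors. -/
def higherVariation (g : Φ → LocalSeries 𝕜 (parity ε η) d) :
    Fields Φ K → LocalSeries 𝕜 (parity ε η) d
  | .phi i => g i - component 0 (g i)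
  | .z _ => 0
  | .w _ => 0

/-- The variation of the fields under the homotopy `∫ z_k δ/δw_k`. -/
def homotopyVariation (𝕜 : Type*) [Field 𝕜] (ε : Φ → ZMod 2) (η : K → ZMod 2) (d : ℕ) :
    Fields Φ K → LocalSeries 𝕜 (parity ε η) d
  | .phi _ => 0
  | .z _ => 0
  | .w k => var 𝕜 (jetParity (parity ε η) d) (Fields.z k, 0)

theorem variation_eq (g : Φ → LocalSeries 𝕜 (parity ε η) d) :
    variation g = fun a => leadingVariation g a + higherVariation g a := by
  funext a
  cases a
  · exact (add_sub_cancel _ _).symm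
  · exact (add_zero _).symm
  · exact (add_zero _).symm

theorem hasParity_leadingVariation {g : Φ → LocalSeries 𝕜 (parity ε η) d}
    (hg : ∀ i, HasParity (g i) (ε i + 1)) (a : Fields Φ K) :
    HasParity (leadingVariation g a) (parity ε η a + 1) := by
  cases a with
  | phi i =>
    intro l hl
    show (if doubletDegree l = 0 then (g i).1 l else 0) = 0
    rw [hg i l hl, ite_self]
  | z k => exact hasParity_var _ _
  | w k => exact fun _ _ => rfl

theorem hasParity_homotopyVariation (a : Fields Φ K) :
    HasParity (homotopyVariation 𝕜 ε η d a) (parity ε η a + 1) := by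
  cases a with
  | phi i => exact fun _ _ => rfl
  | z k => exact fun _ _ => rfl
  | w k =>
    have h : parity ε η (Fields.w k : Fields Φ K) + 1 = η k := by
      show η k + 1 + 1 = η k
      rw [add_assoc, CharTwo.add_self_eq_zero, add_zero]
    rw [h]
    exact hasParity_var (jetParity (parity ε η) d) (Fields.z k, 0)

theorem higherVariation_mem_filtration (g : Φ → LocalSeries 𝕜 (parity ε η) d)
    (a : Fields Φ K) :
    higherVariation g a ∈ filtration 𝕜 (parity ε η) d (fieldDegree a + 1) := by
  cases a with
  | phi i => exact sub_component_zero_mem_filtration (g i)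
  | z k => exact Submodule.zero_mem _
  | w k => exact Submodule.zero_mem _

theorem homotopyVariation_mem_filtration (a : Fields Φ K) :
    homotopyVariation 𝕜 ε η d a ∈ filtration 𝕜 (parity ε η) d (fieldDegree a + 0) := by
  cases a with
  | phi i => exact Submodule.zero_mem _
  | z k => exact Submodule.zero_mem _
  | w k => exact var_mem_filtration (Fields.z k, 0)

theorem homotopyVariation_mem_filtration_one (a : Fields Φ K) :
    homotopyVariation 𝕜 ε η d a ∈ filtration 𝕜 (parity ε η) d 1 := by
  cases a with
  | phi i => exact Submodule.zero_mem _
  | z k => exact Submodule.zero_mem _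
  | w k => exact var_mem_filtration (Fields.z k, 0)

variable [Finite Φ] [Finite K]

theorem evolution_homotopyVariation_independent {X : LocalSeries 𝕜 (parity ε η) d}
    (hX : X ∈ independentSeries 𝕜 (parity ε η) d) :
    evolution (homotopyVariation 𝕜 ε η d) X = 0 := by
  refine Subtype.ext (funext fun l => ?_)
  by_contra hne
  obtain ⟨⟨a, I⟩, l₁, l₂, -, h1, h2⟩ := evolution_support hne
  cases a with
  | phi i => exact h1 (by simp [homotopyVariation])
  | z k => exact h1 (by simp [homotopyVariation])
  | w k => exact h2 (hX _ (by simp [doubletDegree, fieldDegree]))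

/-- The counting operator of the doublets, as an evolutionary vector field. -/
theorem evolution_counting_apply (X : LocalSeries 𝕜 (parity ε η) d)
    (l : List (Jet (Fields Φ K) d)) :
    (evolution (fun a => (fieldDegree a : 𝕜) • var 𝕜 (jetParity (parity ε η) d) (a, 0)) X).1 l
      = (doubletDegree l : 𝕜) * X.1 l := by
  have e : (fun v : Jet (Fields Φ K) d => totalDerivs (parity ε η) v.2
        ((fieldDegree v.1 : 𝕜) • var 𝕜 (jetParity (parity ε η) d) (v.1, 0)))
      = fun v => (fieldDegree v.1 : 𝕜) • var 𝕜 (jetParity (parity ε η) d) v := by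
    funext v
    rw [map_smul, totalDerivs_var]
  have hfin := prolongation_locallyFinite fun a : Fields Φ K =>
    (fieldDegree a : 𝕜) • var 𝕜 (jetParity (parity ε η) d) (a, 0)
  rw [evolution, vectorField_congr e hfin (e ▸ hfin), vectorField_diagonal]
  congr 1
  simp only [doubletDegree, Nat.cast_list_sum, List.map_map]
  rfl

/-- The homotopy formula: the anticommutator of the leading part of the differential with
`∫ z_k δ/δw_k` counts the doublet factors. -/
theorem leading_homotopy_apply {g : Φ → LocalSeries 𝕜 (parity ε η) d}
    (hg : ∀ i, HasParity (g i) (ε i + 1)) (X : LocalSeries 𝕜 (parity ε η) d)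
    (l : List (Jet (Fields Φ K) d)) :
    (evolution (leadingVariation g) (evolution (homotopyVariation 𝕜 ε η d) X)
      + evolution (homotopyVariation 𝕜 ε η d) (evolution (leadingVariation g) X)).1 l
      = (doubletDegree l : 𝕜) * X.1 l := by
  rw [evolution_anticommutator (hasParity_leadingVariation hg) hasParity_homotopyVariation
    (c := fun a => (fieldDegree a : 𝕜) • var 𝕜 (jetParity (parity ε η) d) (a, 0)),
    evolution_counting_apply]
  intro a
  cases a with
  | phi i =>
    show ((0 : ℕ) : 𝕜) • _ = evolution _ 0 + evolution _ (component 0 (g i))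
    rw [map_zero, evolution_homotopyVariation_independent (component_zero_mem (g i)),
      Nat.cast_zero, zero_smul, add_zero]
  | z k =>
    show ((1 : ℕ) : 𝕜) • _ = evolution _ 0
      + evolution _ (var 𝕜 (jetParity (parity ε η) d) (Fields.w k, 0))
    rw [map_zero, evolution_var, Nat.cast_one, one_smul, zero_add]
    rfl
  | w k =>
    show ((1 : ℕ) : 𝕜) • _
      = evolution _ (var 𝕜 (jetParity (parity ε η) d) (Fields.z k, 0)) + evolution _ 0
    rw [map_zero, evolution_var, Nat.cast_one, one_smul, add_zero]
    rfl

/-- The anticommutator of the differential with the homotopy `∫ z_k δ/δw_k`, made invertible on the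
series without doublets by adding the projection onto them. -/
def homotopyOperator (g : Φ → LocalSeries 𝕜 (parity ε η) d) :
    LocalSeries 𝕜 (parity ε η) d →ₗ[𝕜] LocalSeries 𝕜 (parity ε η) d :=
  evolution (variation g) ∘ₗ evolution (homotopyVariation 𝕜 ε η d)
    + evolution (homotopyVariation 𝕜 ε η d) ∘ₗ evolution (variation g) + component 0

theorem homotopyOperator_bijective [CharZero 𝕜] {g : Φ → LocalSeries 𝕜 (parity ε η) d}
    (hg : ∀ i, HasParity (g i) (ε i + 1)) : Function.Bijective (homotopyOperator g) := by
  refine bijective_of_sub_scale_mem (ω := fun n => if n = 0 then 1 else (n : 𝕜)) ?_ ?_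
  · intro n
    split_ifs with h
    · exact one_ne_zero
    · exact Nat.cast_ne_zero.2 h
  · intro n X hX
    have hh : ∀ {m : ℕ} {Y : LocalSeries 𝕜 (parity ε η) d}, Y ∈ filtration 𝕜 (parity ε η) d m →
        evolution (homotopyVariation 𝕜 ε η d) Y ∈ filtration 𝕜 (parity ε η) d m :=
      fun hY => evolution_mem_filtration_add homotopyVariation_mem_filtration hY
    have hS : ∀ {m : ℕ} {Y : LocalSeries 𝕜 (parity ε η) d}, Y ∈ filtration 𝕜 (parity ε η) d m →
        evolution (higherVariation g) Y ∈ filtration 𝕜 (parity ε η) d (m + 1) :=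
      fun hY => evolution_mem_filtration_add (higherVariation_mem_filtration g) hY
    have e : homotopyOperator g X - scale (parity ε η) d (fun n => if n = 0 then 1 else (n : 𝕜)) X
        = evolution (higherVariation g) (evolution (homotopyVariation 𝕜 ε η d) X)
          + evolution (homotopyVariation 𝕜 ε η d) (evolution (higherVariation g) X) := by
      have h1 : homotopyOperator g X
          = (evolution (leadingVariation g) (evolution (homotopyVariation 𝕜 ε η d) X)
              + evolution (homotopyVariation 𝕜 ε η d) (evolution (leadingVariation g) X))
            + (evolution (higherVariation g) (evolution (homotopyVariation 𝕜 ε η d) X)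
              + evolution (homotopyVariation 𝕜 ε η d) (evolution (higherVariation g) X))
            + component 0 X := by
        show evolution (variation g) _ + evolution _ (evolution (variation g) X) + _ = _
        rw [variation_eq, evolution_add, evolution_add, map_add]
        abel
      have h2 : scale (parity ε η) d (fun n => if n = 0 then 1 else (n : 𝕜)) X
          = (evolution (leadingVariation g) (evolution (homotopyVariation 𝕜 ε η d) X)
              + evolution (homotopyVariation 𝕜 ε η d) (evolution (leadingVariation g) X))
            + component 0 X := by
        refine Subtype.ext (funext fun l => ?_)
        refine Eq.trans ?_ (congrArg (· + (component 0 X).1 l)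
          (leading_homotopy_apply hg X l).symm)
        show (if doubletDegree l = 0 then 1 else (doubletDegree l : 𝕜)) * X.1 l
          = (doubletDegree l : 𝕜) * X.1 l + if doubletDegree l = 0 then X.1 l else 0
        split_ifs with h
        · rw [h, Nat.cast_zero, zero_mul, one_mul, zero_add]
        · rw [add_zero]
      rw [h1, h2]
      abel
    rw [e]
    exact Submodule.add_mem _ (hS (hh hX)) (hh (hS hX))

theorem homotopyOperator_totalDeriv (g : Φ → LocalSeries 𝕜 (parity ε η) d) (μ : Fin d)
    (X : LocalSeries 𝕜 (parity ε η) d) :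
    homotopyOperator g (totalDeriv (parity ε η) μ X)
      = totalDeriv (parity ε η) μ (homotopyOperator g X) := by
  simp only [homotopyOperator, LinearMap.add_apply, LinearMap.comp_apply, evolution_totalDeriv,
    component_totalDeriv, map_add]

theorem component_zero_evolution_homotopy (X : LocalSeries 𝕜 (parity ε η) d) :
    component 0 (evolution (homotopyVariation 𝕜 ε η d) X) = 0 :=
  component_zero_eq_zero (evolution_mem_filtration homotopyVariation_mem_filtration_one X)

/-- The projection onto the series without doublets intertwines the differential and the reduced
differential. -/
theorem component_zero_evolution (g : Φ → LocalSeries 𝕜 (parity ε η) d)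
    (X : LocalSeries 𝕜 (parity ε η) d) :
    component 0 (evolution (variation g) X) = evolution (reducedVariation g) (component 0 X) := by
  have hred : ∀ a, reducedVariation g a ∈ filtration 𝕜 (parity ε η) d (fieldDegree a + 0) := by
    rintro (i | k | k)
    · exact mem_filtration_zero _
    · exact Submodule.zero_mem _
    · exact Submodule.zero_mem _
  have hdiff : ∀ a, variation g a - reducedVariation g a ∈ filtration 𝕜 (parity ε η) d 1 := by
    rintro (i | k | k)
    · exact sub_component_zero_mem_filtration (g i)
    · exact Submodule.sub_mem _ (var_mem_filtration (Fields.w k, 0)) (Submodule.zero_mem _)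
    · exact Submodule.sub_mem _ (Submodule.zero_mem _) (Submodule.zero_mem _)
  have hind : ∀ a, reducedVariation g a ∈ independentSeries 𝕜 (parity ε η) d := by
    rintro (i | k | k)
    · exact component_zero_mem _
    · exact Submodule.zero_mem _
    · exact Submodule.zero_mem _
  have e : evolution (variation g) X
      = evolution (reducedVariation g) (component 0 X)
        + evolution (reducedVariation g) (X - component 0 X)
        + evolution (fun a => variation g a - reducedVariation g a) X := by
    rw [← map_add, add_sub_cancel, ← evolution_add]
    congr 2
    exact funext fun a => (add_sub_cancel _ _).symm
  rw [e, map_add, map_add, component_zero_eq_self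
      (evolution_independent _ hind (component_zero_mem X)),
    component_zero_eq_zero (evolution_mem_filtration_add (r := 0) (n := 1) hred
      (sub_component_zero_mem_filtration X)),
    component_zero_eq_zero (evolution_mem_filtration hdiff X), add_zero, add_zero]

end Homotopy

/-! ### Passage to integrated functionals -/

section Functionals

variable {𝕜 : Type*} [Field 𝕜] {F : Type*} {d : ℕ}

/-- A bijective operator on densities that commutes with the total derivatives is bijective on
integrated functionals. -/
theorem mapQ_totalDivergences_bijective {p : F → ZMod 2}
    {P : LocalSeries 𝕜 p d →ₗ[𝕜] LocalSeries 𝕜 p d} (hP : Function.Bijective P)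
    (hcomm : ∀ μ X, P (totalDeriv p μ X) = totalDeriv p μ (P X)) :
    Function.Bijective ((totalDivergences 𝕜 p d).mapQ (totalDivergences 𝕜 p d) P
      (totalDivergences_le_comap p P hcomm)) := by
  have hle : totalDivergences 𝕜 p d ≤ (totalDivergences 𝕜 p d).map P := by
    refine iSup_le fun μ => ?_
    rintro _ ⟨Y, rfl⟩
    obtain ⟨X, rfl⟩ := hP.2 Y
    exact ⟨totalDeriv p μ X, Submodule.mem_iSup_of_mem μ ⟨X, rfl⟩, hcomm μ X⟩
  constructor
  · refine (injective_iff_map_eq_zero _).2 fun x hx => ?_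
    obtain ⟨X, rfl⟩ := Submodule.Quotient.mk_surjective _ x
    rw [Submodule.mapQ_apply, Submodule.Quotient.mk_eq_zero] at hx
    obtain ⟨Z, hZ, hZX⟩ := hle hx
    rw [Submodule.Quotient.mk_eq_zero, ← hP.1 hZX]
    exact hZ
  · intro y
    obtain ⟨Y, rfl⟩ := Submodule.Quotient.mk_surjective _ y
    obtain ⟨X, rfl⟩ := hP.2 Y
    exact ⟨Submodule.Quotient.mk X, rfl⟩

end Functionals

/-! ### Contraction of the cohomology -/

section Contraction

variable {𝕜 : Type*} [Field 𝕜] {M N : Type*} [AddCommGroup M] [Module 𝕜 M] [AddCommGroup N]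
  [Module 𝕜 N]

/-- A surjective chain map `π` induces an isomorphism in cohomology if there is an operator `h`
with values in `ker π` whose anticommutator with the differential restricts to a bijection of
`ker π`. -/
theorem exists_cohomology_equiv {s h : M →ₗ[𝕜] M} {t : N →ₗ[𝕜] N} {π : M →ₗ[𝕜] N}
    (hs : ∀ x, s (s x) = 0) (hπ : Function.Surjective π) (hπs : ∀ x, π (s x) = t (π x))
    (hπh : ∀ x, π (h x) = 0)
    (hinj : ∀ x, π x = 0 → s (h x) + h (s x) = 0 → x = 0)
    (hsurj : ∀ x, π x = 0 → ∃ r, π r = 0 ∧ s (h r) + h (s r) = x) :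
    ∃ e : Cohomology s ≃ₗ[𝕜] Cohomology t, ∀ (x : M) (hx : s x = 0), ∃ hy : t (π x) = 0,
      e (Cohomology.mk s x hx) = Cohomology.mk t (π x) hy := by
  have acyclic : ∀ x, π x = 0 → s x = 0 → ∃ y, π y = 0 ∧ s y = x := by
    intro x hx hsx
    obtain ⟨r, hr, rfl⟩ := hsurj x hx
    rw [map_add, hs, zero_add] at hsx
    -- `s r` is annihilated by the anticommutator, hence vanishes.
    have hsr : s r = 0 := by
      refine hinj _ (by rw [hπs, hr, map_zero]) ?_
      rw [hs, map_zero, add_zero, hsx]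
    exact ⟨h r, hπh r, by rw [hsr, map_zero, add_zero]⟩
  have hker : ∀ x : LinearMap.ker s, π x ∈ LinearMap.ker t := by
    intro x
    rw [LinearMap.mem_ker, ← hπs, LinearMap.mem_ker.1 x.2, map_zero]
  let f : LinearMap.ker s →ₗ[𝕜] LinearMap.ker t :=
    (π ∘ₗ (LinearMap.ker s).subtype).codRestrict _ hker
  have hf : (LinearMap.range s).comap (LinearMap.ker s).subtype
      ≤ ((LinearMap.range t).comap (LinearMap.ker t).subtype).comap f := by
    rintro x ⟨y, hy⟩
    refine ⟨π y, ?_⟩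
    rw [← hπs, hy]
    rfl
  refine ⟨LinearEquiv.ofBijective (Submodule.mapQ _ _ f hf) ⟨?_, ?_⟩, fun x hx => ?_⟩
  · refine (injective_iff_map_eq_zero _).2 fun c hc => ?_
    obtain ⟨⟨x, hx⟩, rfl⟩ := Submodule.Quotient.mk_surjective _ c
    rw [Submodule.mapQ_apply, Submodule.Quotient.mk_eq_zero] at hc
    obtain ⟨b, hb⟩ := hc
    obtain ⟨y, rfl⟩ := hπ b
    have hb' : t (π y) = π x := hb
    obtain ⟨u, -, hu⟩ := acyclic (x - s y) (by rw [map_sub, hπs, hb', sub_self])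
      (by rw [map_sub, hs, LinearMap.mem_ker.1 hx, sub_zero])
    rw [Submodule.Quotient.mk_eq_zero]
    exact ⟨u + y, by rw [map_add, hu, sub_add_cancel]; rfl⟩
  · intro c
    obtain ⟨⟨b, hb⟩, rfl⟩ := Submodule.Quotient.mk_surjective _ c
    obtain ⟨y, rfl⟩ := hπ b
    obtain ⟨u, hu, hsu⟩ := acyclic (s y) (by rw [hπs, LinearMap.mem_ker.1 hb]) (hs y)
    refine ⟨Submodule.Quotient.mk ⟨y - u, ?_⟩, ?_⟩
    · rw [LinearMap.mem_ker, map_sub, hsu, sub_self]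
    · rw [Submodule.mapQ_apply]
      congr 1
      refine Subtype.ext ?_
      show π (y - u) = π y
      rw [map_sub, hu, sub_zero]
  · exact ⟨hker ⟨x, hx⟩, rfl⟩

end Contraction

end

end Doublets

open Doublets in
theorem theorem1 {𝕜 : Type*} [Field 𝕜] [CharZero 𝕜] {Φ K : Type*} [Finite Φ] [Finite K]
    {d : ℕ} (ε : Φ → ZMod 2) (η : K → ZMod 2)
    (g : Φ → LocalSeries 𝕜 (parity ε η) d) (hg : ∀ i, HasParity (g i) (ε i + 1))
    (hs : ∀ x, differential g (differential g x) = 0) :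
    (∀ y, reducedDifferential g (reducedDifferential g y) = 0) ∧
    ∃ e : Cohomology (differential g) ≃ₗ[𝕜] Cohomology (reducedDifferential g),
      ∀ (x : Functional 𝕜 (parity ε η) d) (hx : differential g x = 0),
        ∃ h : reducedDifferential g (degreeZero 𝕜 (parity ε η) d x) = 0,
          e (Cohomology.mk (differential g) x hx)
            = Cohomology.mk (reducedDifferential g) (degreeZero 𝕜 (parity ε η) d x) h := by
  have hπ : Function.Surjective (degreeZero 𝕜 (parity ε η) d) := by
    rintro ⟨_, X, hX, rfl⟩
    exact ⟨integral 𝕜 _ d X, Subtype.ext (congrArg (integral 𝕜 _ d) (component_zero_eq_self hX))⟩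
  have hπs : ∀ x, degreeZero 𝕜 (parity ε η) d (differential g x)
      = reducedDifferential g (degreeZero 𝕜 (parity ε η) d x) := by
    intro x
    obtain ⟨X, rfl⟩ := Submodule.Quotient.mk_surjective _ x
    exact Subtype.ext (congrArg (integral 𝕜 _ d) (component_zero_evolution g X))
  have hπh : ∀ x, degreeZero 𝕜 (parity ε η) d
      (functionalEvolution (homotopyVariation 𝕜 ε η d) x) = 0 := by
    intro x
    obtain ⟨X, rfl⟩ := Submodule.Quotient.mk_surjective _ x
    refine Subtype.ext ((congrArg (integral 𝕜 _ d) (component_zero_evolution_homotopy X)).trans ?_)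
    exact map_zero _
  -- `P` is `s h + h s + π` on functionals.
  have hbij := mapQ_totalDivergences_bijective (homotopyOperator_bijective hg)
    (homotopyOperator_totalDeriv g)
  set P := (totalDivergences 𝕜 (parity ε η) d).mapQ (totalDivergences 𝕜 (parity ε η) d)
    (homotopyOperator g) (totalDivergences_le_comap _ _ (homotopyOperator_totalDeriv g)) with hPdef
  have hP : ∀ x, P x = differential g (functionalEvolution (homotopyVariation 𝕜 ε η d) x)
      + functionalEvolution (homotopyVariation 𝕜 ε η d) (differential g x)
      + (degreeZero 𝕜 (parity ε η) d x : Functional 𝕜 (parity ε η) d) := by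
    intro x
    obtain ⟨X, rfl⟩ := Submodule.Quotient.mk_surjective _ x
    rfl
  have hπP : ∀ x, degreeZero 𝕜 (parity ε η) d (P x) = degreeZero 𝕜 (parity ε η) d x := by
    intro x
    have hidem : degreeZero 𝕜 (parity ε η) d
        (degreeZero 𝕜 (parity ε η) d x : Functional 𝕜 (parity ε η) d)
        = degreeZero 𝕜 (parity ε η) d x := by
      obtain ⟨X, rfl⟩ := Submodule.Quotient.mk_surjective _ x
      exact Subtype.ext (congrArg (integral 𝕜 _ d) (component_zero_eq_self (component_zero_mem X)))
    rw [hP, map_add, map_add, hπs, hπh, hπh, map_zero, zero_add, zero_add, hidem]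
  refine ⟨fun y => ?_, exists_cohomology_equiv
    (h := functionalEvolution (homotopyVariation 𝕜 ε η d)) hs hπ hπs hπh ?_ ?_⟩
  · obtain ⟨x, rfl⟩ := hπ y
    rw [← hπs, ← hπs, hs, map_zero]
  · intro x hx h0
    refine hbij.1 ?_
    rw [hP, h0, hx, map_zero]
    exact add_zero _
  · intro x hx
    obtain ⟨r, rfl⟩ := hbij.2 x
    rw [hπP] at hx
    refine ⟨r, hx, ?_⟩
    rw [hP, hx]
    exact (add_zero _).symm
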